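/- Let $R=\bigoplus_{n\ge 0}R^n$ be a Noetherian graded-commutative ring, and let $d\ge 2$ be an even integer such that $R$ is generated as a ring by $R^0$ and $R^d$ (so that $R$ is commutative). Let $\mathsf T$ be an $R$-linear triangulated category with shift $\Sigma$: there is given a homomorphism $\phi$ of graded rings from $R$ to the graded center of $\mathsf T$, whose degree $n$ component consists of the natural transformations $\eta:\mathrm{id}_{\mathsf T}\to\Sigma^n$ with $\eta\Sigma=(-1)^n\Sigma\eta$. Write $\phi_Y(z):Y\to\Sigma^nY$ for the morphism given by $z\in R^n$. For objects $X,Y$ of $\mathsf T$, the group $\operatorname{Hom}^*_{\mathsf T}(X,Y)=\bigoplus_{n\in\mathbb Z}\operatorname{Hom}_{\mathsf T}(X,\Sigma^nY)$ is a graded $R$-module, where $z\in R^k$ sends $f\in \operatorname{Hom}_{\mathsf T}(X,\Sigma^nY)$ to $\Sigma^n\phi_Y(z)\circ f$. Put $\lambda^n(X,Y)=\ell_{R^0}\operatorname{Hom}_{\mathsf T}(X,\Sigma^nY)$. Let $X,Y$ be objects of $\mathsf T$ such that $\bigoplus_{n\ge n_0}\operatorname{Hom}_{\mathsf T}(X,\Sigma^nY)$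 is a Noetherian $R$-module for some $n_0\in\mathbb Z$ and $\lambda^n(X,Y)<\infty$ for all $n\in\mathbb Z$. Then for each $i=0,\dots,d-1$ there is a polynomial $g_i\in\mathbb Q[t]$ (necessarily unique) with $g_i(n)=\lambda^{dn+i}(X,Y)$ for all $n\gg 0$; the complexity is $\operatorname{cx}(X,Y)=1+\max_i\deg g_i$, where $\deg 0=-1$. Put $h(X,Y)(n)=\sum_{i=0}^{d-1}(-1)^{n+i}\lambda^{n+i}(X,Y)$, and $\Delta f(n)=f(n+d)-f(n)$ for $f:\mathbb Z\to\mathbb Z$. Assume that $R^0$ contains an infinite field, or is local with infinite residue field. Let $s=\operatorname{cx}(X,Y)\ge 0$, and assume that $\lambda^n(X,Y)=0$ for all $n\ll 0$. The multiplicity $e^s(X,Y)$ is defined, for $s\ge 1$, as the value of $\Delta^{s-1}h(X,Y)(n)$ for $n\gg 0$ (this is constant for $n\gg 0$), and, for $s=0$, as $e^0(X,Y)=\sum_{n\in\mathbb Z}(-1)^n\lambda^n(X,Y)$. For an object $Z$ and $z\in R^d$, the Koszul object $Z/\!\!/z$ is defined by a distinguished triangle $Z\xrightarrow{\phi_Z(z)}\Sigma^dZ\to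 Z/\!\!/z\to\Sigma Z$, and $Z/\!\!/(z_1,\dots,z_r)=(Z/\!\!/(z_1,\dots,z_{r-1}))/\!\!/z_r$, with $Z/\!\!/()=Z$. Then there are elements $z_1,\dots,z_s\in R^d$ such that $\lambda^n(X,Y/\!\!/(z_1,\dots,z_s))$ is finite for every $n\in\mathbb Z$ and zero for all but finitely many $n$, and $$e^s(X,Y)=\sum_{n\in\mathbb Z}(-1)^n\lambda^n\bigl(X,Y/\!\!/(z_1,\dots,z_s)\bigr).$$ -/

import Mathlib

open CategoryTheory CategoryTheory.Pretriangulated Filter DirectSum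

noncomputable section

namespace TriMult

universe v u w

/-! ### The graded center and central ring actions -/

section Center

variable (T : Type u) [Category.{v} T] [Preadditive T] [HasShift T ℤ]
  [∀ n : ℤ, (shiftFunctor T n).Additive]

/-- The degree `n` component of the graded center of `T`: the natural transformations
`η : id ⟶ Σⁿ` such that `η Σ = (-1)ⁿ Σ η` (up to the canonical isomorphism `Σ Σⁿ ≅ Σⁿ Σ`). -/
def gradedCenter (n : ℤ) : AddSubgroup (𝟭 T ⟶ shiftFunctor T n) where
  carrier := {η | ∀ X : T, η.app (X⟦(1 : ℤ)⟧) =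
    n.negOnePow • ((η.app X)⟦(1 : ℤ)⟧' ≫ (shiftComm X n 1).hom)}
  zero_mem' := by intro X; simp
  add_mem' := by
    intro a b ha hb X
    have h1 := ha X
    have h2 := hb X
    simp only [NatTrans.app_add, Functor.map_add, Preadditive.add_comp, smul_add, h1, h2]
  neg_mem' := by
    intro a ha X
    have h1 := ha X
    simp only [NatTrans.app_neg, Functor.map_neg, Preadditive.neg_comp, smul_neg, h1]

variable {T}
variable {R : Type w} [CommRing R] (𝒜 : ℕ → AddSubgroup R) [GradedRing 𝒜]

variable (T) in
/-- An `R`-linear structure on `T`: a homomorphism of graded rings from `R = ⨁ Rⁿ` to the graded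
center of `T`. The product of `η` (degree `m`) and `ξ` (degree `n`) in the graded center is
`X ⟶ Σⁿ X ⟶ Σⁿ Σᵐ X ≅ Σᵐ⁺ⁿ X`, the composition of `ξ` and `Σⁿ η`. -/
structure CentralAction where
  /-- The additive map in each degree. -/
  toCenter (n : ℕ) : 𝒜 n →+ gradedCenter T (n : ℤ)
  map_one (X : T) : (toCenter 0 1).1.app X = ShiftedHom.mk₀ ((0 : ℕ) : ℤ) rfl (𝟙 X)
  map_mul (m n : ℕ) (x : 𝒜 m) (y : 𝒜 n) (X : T) :
    (toCenter (m + n) ⟨(x : R) * (y : R), SetLike.mul_mem_graded x.2 y.2⟩).1.app X =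
      ShiftedHom.comp (((toCenter n y).1.app X : X ⟶ X⟦(n : ℤ)⟧))
        (((toCenter m x).1.app X : X ⟶ X⟦(m : ℤ)⟧)) (Nat.cast_add m n).symm

variable {𝒜}

/-- The morphism `φ_X(z) : X ⟶ Σⁿ X` attached to `z ∈ Rⁿ`. -/
def CentralAction.hom (φ : CentralAction T 𝒜) {n : ℕ} (z : 𝒜 n) (X : T) : X ⟶ X⟦(n : ℤ)⟧ :=
  (φ.toCenter n z).1.app X

variable (φ : CentralAction T 𝒜)

lemma CentralAction.hom_add {n : ℕ} (x y : 𝒜 n) (X : T) :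
    φ.hom (x + y) X = φ.hom x X + φ.hom y X := by
  simp [CentralAction.hom]

lemma CentralAction.hom_zero {n : ℕ} (X : T) : φ.hom (0 : 𝒜 n) X = 0 := by
  simp [CentralAction.hom]

lemma CentralAction.hom_one (X : T) :
    φ.hom (1 : 𝒜 0) X = ShiftedHom.mk₀ ((0 : ℕ) : ℤ) rfl (𝟙 X) := φ.map_one X

lemma CentralAction.hom_mul {m n : ℕ} (x : 𝒜 m) (y : 𝒜 n) (X : T) {k : ℕ} (hk : m + n = k)
    (z : 𝒜 k) (hz : (z : R) = x * y) :
    φ.hom z X = ShiftedHom.comp (φ.hom y X) (φ.hom x X) (by subst hk; push_cast; rfl) := by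
  subst hk
  obtain rfl : z = ⟨(x : R) * (y : R), SetLike.mul_mem_graded x.2 y.2⟩ := Subtype.ext hz
  exact φ.map_mul m n x y X

/-! ### The graded module `Hom*(X, Y)` -/

/-- The group `Hom(X, Σⁿ Y)`, with the `R⁰`-module structure given by `φ`. -/
@[nolint unusedArguments]
def HomDeg (_φ : CentralAction T 𝒜) (X Y : T) (n : ℤ) : Type v := X ⟶ Y⟦n⟧

instance (X Y : T) (n : ℤ) : AddCommGroup (HomDeg φ X Y n) :=
  inferInstanceAs (AddCommGroup (X ⟶ Y⟦n⟧))

/-- Multiplication by `z ∈ Rᵏ`, as a map `Hom(X, Σⁿ Y) → Hom(X, Σᵐ Y)` for `m = n + k`: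
it sends `f` to the composition of `f` with `Σⁿ φ_Y(z) : Σⁿ Y ⟶ Σⁿ Σᵏ Y ≅ Σᵐ Y`. -/
def act (X Y : T) {k : ℕ} (z : 𝒜 k) (n m : ℤ) (h : k + n = m) :
    HomDeg φ X Y n →+ HomDeg φ X Y m where
  toFun f := ShiftedHom.comp (show X ⟶ Y⟦n⟧ from f) (φ.hom z Y) h
  map_zero' := ShiftedHom.zero_comp X n _ h
  map_add' f g := ShiftedHom.add_comp (show X ⟶ Y⟦n⟧ from f) (show X ⟶ Y⟦n⟧ from g) _ h

lemma act_one (X Y : T) (n m : ℤ) (h : ((0 : ℕ) : ℤ) + n = m) (f : HomDeg φ X Y n) :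
    act φ X Y (1 : 𝒜 0) n m h f = cast (by rw [← h]; simp) f := by
  obtain rfl : n = m := by simpa using h
  change ShiftedHom.comp _ _ _ = f
  rw [φ.hom_one]
  exact ShiftedHom.comp_mk₀_id (show X ⟶ Y⟦n⟧ from f) _ rfl

lemma act_add (X Y : T) {k : ℕ} (x y : 𝒜 k) (n m : ℤ) (h : k + n = m) (f : HomDeg φ X Y n) :
    act φ X Y (x + y) n m h f = act φ X Y x n m h f + act φ X Y y n m h f := by
  change ShiftedHom.comp _ _ _ = ShiftedHom.comp _ _ _ + ShiftedHom.comp _ _ _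
  rw [φ.hom_add]
  exact ShiftedHom.comp_add _ _ _ h

lemma act_zero (X Y : T) {k : ℕ} (n m : ℤ) (h : k + n = m) (f : HomDeg φ X Y n) :
    act φ X Y (0 : 𝒜 k) n m h f = 0 := by
  change ShiftedHom.comp _ _ _ = _
  rw [φ.hom_zero]
  exact ShiftedHom.comp_zero Y _ h

lemma act_mul (X Y : T) {j k l : ℕ} (x : 𝒜 j) (y : 𝒜 k) (hl : j + k = l) (z : 𝒜 l)
    (hz : (z : R) = x * y) (n m p : ℤ) (h : k + n = m) (h' : j + m = p) (h'' : l + n = p)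
    (f : HomDeg φ X Y n) :
    act φ X Y z n p h'' f = act φ X Y x m p h' (act φ X Y y n m h f) := by
  change ShiftedHom.comp _ _ _ = ShiftedHom.comp (ShiftedHom.comp _ _ _) _ _
  rw [φ.hom_mul x y Y hl z hz]
  refine (ShiftedHom.comp_assoc _ _ _ _ _ ?_).symm
  omega

instance (X Y : T) (n : ℤ) : Module (𝒜 0) (HomDeg φ X Y n) where
  smul r f := act φ X Y r n n (by simp) f
  one_smul f := act_one φ X Y n n (by simp) f
  mul_smul r s f := act_mul φ X Y r s (zero_add 0) (r * s) rfl n n n _ _ _ f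
  smul_zero r := (act φ X Y r n n (by simp)).map_zero
  smul_add r := (act φ X Y r n n (by simp)).map_add
  add_smul r s f := act_add φ X Y r s n n _ f
  zero_smul f := act_zero φ X Y n n _ f

/-- The graded abelian group `Hom*(X, Y) = ⨁ₙ Hom(X, Σⁿ Y)`, `n ∈ ℤ`. -/
def HomStar (X Y : T) : Type v := ⨁ n : ℤ, HomDeg φ X Y n

instance (X Y : T) : AddCommGroup (HomStar φ X Y) :=
  inferInstanceAs (AddCommGroup (⨁ n : ℤ, HomDeg φ X Y n))

/-- The homogeneous element of `Hom*(X, Y)` given by an element of `Hom(X, Σⁿ Y)`. -/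
def HomStar.of (X Y : T) (n : ℤ) : HomDeg φ X Y n →+ HomStar φ X Y :=
  DirectSum.of (fun n : ℤ => HomDeg φ X Y n) n

/-- The degree `n` component of an element of `Hom*(X, Y)`. -/
def HomStar.component (X Y : T) (n : ℤ) : HomStar φ X Y →+ HomDeg φ X Y n :=
  DFinsupp.evalAddMonoidHom n

lemma HomStar.component_of_same (X Y : T) (n : ℤ) (f : HomDeg φ X Y n) :
    HomStar.component φ X Y n (HomStar.of φ X Y n f) = f :=
  DirectSum.of_eq_same (β := fun n : ℤ => HomDeg φ X Y n) n f

lemma HomStar.component_of_ne (X Y : T) (n m : ℤ) (h : n ≠ m) (f : HomDeg φ X Y n) :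
    HomStar.component φ X Y m (HomStar.of φ X Y n f) = 0 :=
  DirectSum.of_eq_of_ne (β := fun n : ℤ => HomDeg φ X Y n) n m f (Ne.symm h)

/-- The additive map out of `Hom*(X, Y)` given by additive maps on the components. -/
def HomStar.lift (X Y : T) {A : Type*} [AddCommMonoid A] (g : ∀ n : ℤ, HomDeg φ X Y n →+ A) :
    HomStar φ X Y →+ A :=
  DirectSum.toAddMonoid g

lemma HomStar.lift_of (X Y : T) {A : Type*} [AddCommMonoid A] (g : ∀ n : ℤ, HomDeg φ X Y n →+ A)
    (n : ℤ) (f : HomDeg φ X Y n) : HomStar.lift φ X Y g (HomStar.of φ X Y n f) = g n f :=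
  DirectSum.toAddMonoid_of g n f

lemma HomStar.addHom_ext (X Y : T) {A : Type*} [AddCommMonoid A] {g g' : HomStar φ X Y →+ A}
    (h : ∀ n (f : HomDeg φ X Y n), g (HomStar.of φ X Y n f) = g' (HomStar.of φ X Y n f)) :
    g = g' :=
  DirectSum.addHom_ext (β := fun n : ℤ => HomDeg φ X Y n) h

lemma HomStar.end_ext (X Y : T) {g g' : AddMonoid.End (HomStar φ X Y)}
    (h : ∀ n (f : HomDeg φ X Y n), g (HomStar.of φ X Y n f) = g' (HomStar.of φ X Y n f)) :
    g = g' :=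
  HomStar.addHom_ext φ X Y h

/-- Multiplication by `z ∈ Rᵏ` on `Hom*(X, Y)`. -/
def mulStar (X Y : T) {k : ℕ} (z : 𝒜 k) : AddMonoid.End (HomStar φ X Y) :=
  HomStar.lift φ X Y fun n => (HomStar.of φ X Y (k + n)).comp (act φ X Y z n _ rfl)

lemma mulStar_of (X Y : T) {k : ℕ} (z : 𝒜 k) (n m : ℤ) (h : k + n = m) (f : HomDeg φ X Y n) :
    mulStar φ X Y z (HomStar.of φ X Y n f) = HomStar.of φ X Y m (act φ X Y z n m h f) := by
  subst h
  exact HomStar.lift_of φ X Y _ n f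

/-- Multiplication by `z ∈ Rᵏ` on `Hom*(X, Y)`, as an additive function of `z`. -/
def actStar (X Y : T) (k : ℕ) : 𝒜 k →+ AddMonoid.End (HomStar φ X Y) where
  toFun z := mulStar φ X Y z
  map_zero' := by
    refine HomStar.end_ext φ X Y fun n f => ?_
    rw [mulStar_of φ X Y _ n _ rfl, act_zero, map_zero]
    rfl
  map_add' x y := by
    refine HomStar.end_ext φ X Y fun n f => ?_
    change _ = mulStar φ X Y x _ + mulStar φ X Y y _
    rw [mulStar_of φ X Y _ n _ rfl, mulStar_of φ X Y _ n _ rfl,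
      mulStar_of φ X Y _ n _ rfl, act_add, map_add]

lemma actStar_one (X Y : T) : actStar φ X Y 0 (1 : 𝒜 0) = 1 := by
  refine HomStar.end_ext φ X Y fun n f => ?_
  refine (mulStar_of φ X Y (1 : 𝒜 0) n n (by simp) f).trans ?_
  rw [act_one]
  rfl

lemma actStar_mul (X Y : T) {i j : ℕ} (x : 𝒜 i) (y : 𝒜 j) :
    actStar φ X Y (i + j) ⟨(x : R) * (y : R), SetLike.mul_mem_graded x.2 y.2⟩ =
      actStar φ X Y i x * actStar φ X Y j y := by
  refine HomStar.end_ext φ X Y fun n f => ?_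
  refine (mulStar_of φ X Y _ n (i + (j + n)) (by push_cast; ring) f).trans ?_
  rw [act_mul φ X Y x y rfl ⟨_, SetLike.mul_mem_graded x.2 y.2⟩ rfl n (j + n) _ rfl rfl]
  exact ((congrArg (mulStar φ X Y x) (mulStar_of φ X Y y n (j + n) rfl f)).trans
    (mulStar_of φ X Y x (j + n) (i + (j + n)) rfl _)).symm

/-- The ring homomorphism from `R` to the endomorphisms of the abelian group `Hom*(X, Y)` that is
determined by the action of the homogeneous elements. -/
def actHom (X Y : T) : R →+* AddMonoid.End (HomStar φ X Y) :=
  (DirectSum.toSemiring (actStar φ X Y) (actStar_one φ X Y) (actStar_mul φ X Y)).comp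
    (DirectSum.decomposeRingEquiv 𝒜).toRingHom

instance (X Y : T) : Module R (HomStar φ X Y) := Module.compHom _ (actHom φ X Y)

/-- The `R`-module structure of `Hom*(X, Y)` on homogeneous elements. -/
lemma smul_of (X Y : T) {k : ℕ} (z : 𝒜 k) (n m : ℤ) (h : k + n = m) (f : HomDeg φ X Y n) :
    (z : R) • HomStar.of φ X Y n f = HomStar.of φ X Y m (act φ X Y z n m h f) := by
  rw [← mulStar_of φ X Y z n m h f]
  change actHom φ X Y (z : R) _ = _
  have h1 : DirectSum.decomposeRingEquiv 𝒜 (z : R) = DirectSum.of (fun i => 𝒜 i) k z :=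
    DirectSum.decompose_coe 𝒜 z
  have h2 : actHom φ X Y (z : R) = actStar φ X Y k z := by
    change DirectSum.toSemiring _ (actStar_one φ X Y) (actStar_mul φ X Y)
      (DirectSum.decomposeRingEquiv 𝒜 (z : R)) = _
    rw [h1]
    exact DirectSum.toSemiring_of _ (actStar_one φ X Y) (actStar_mul φ X Y) k z
  rw [h2]
  rfl

lemma component_smul (X Y : T) {k : ℕ} (z : 𝒜 k) (n m : ℤ) (h : k + n = m)
    (f : HomStar φ X Y) :
    HomStar.component φ X Y m ((z : R) • f) =
      act φ X Y z n m h (HomStar.component φ X Y n f) := by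
  have key : (HomStar.component φ X Y m).comp
      (DistribSMul.toAddMonoidHom (HomStar φ X Y) (z : R)) =
      (act φ X Y z n m h).comp (HomStar.component φ X Y n) := by
    refine HomStar.addHom_ext φ X Y fun i f => ?_
    simp only [AddMonoidHom.comp_apply, DistribSMul.toAddMonoidHom_apply]
    rw [smul_of φ X Y z i (k + i) rfl]
    by_cases hi : i = n
    · subst hi
      subst h
      rw [HomStar.component_of_same, HomStar.component_of_same]
    · rw [HomStar.component_of_ne φ X Y _ _ (by omega), HomStar.component_of_ne φ X Y _ _ hi,
        map_zero]
  exact DFunLike.congr_fun key f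

/-- The `R`-submodule `Hom^{≥ n₀}(X, Y) = ⨁_{n ≥ n₀} Hom(X, Σⁿ Y)` of `Hom*(X, Y)`. -/
def HomStar.ge (X Y : T) (n₀ : ℤ) : Submodule R (HomStar φ X Y) where
  carrier := {f | ∀ n < n₀, HomStar.component φ X Y n f = 0}
  zero_mem' := fun n _ => map_zero _
  add_mem' := fun {a b} ha hb n hn => by rw [map_add, ha n hn, hb n hn, add_zero]
  smul_mem' := by
    intro r f hf
    induction r using DirectSum.Decomposition.inductionOn 𝒜 with
    | zero => intro n _; rw [zero_smul, map_zero]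
    | homogeneous z =>
      intro n hn
      rw [component_smul φ X Y z (n - _) n (by ring), hf _ (by omega), map_zero]
    | add a b ha hb => intro n hn; rw [add_smul, map_add, ha n hn, hb n hn, add_zero]

/-- `Hom*(X, Y)` belongs to `noeth^fl(R)`: it is eventually Noetherian over `R`, and each
`Hom(X, Σⁿ Y)` has finite length over `R⁰`. -/
def IsNoethFL (X Y : T) : Prop :=
  (∃ n₀ : ℤ, IsNoetherian R (HomStar.ge φ X Y n₀)) ∧
    ∀ n : ℤ, IsFiniteLength (𝒜 0) (HomDeg φ X Y n)

/-! ### Lengths, Herbrand difference, complexity and multiplicity -/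

/-- `λⁿ(X, Y)`, the length of `Hom(X, Σⁿ Y)` over `R⁰` (only used when it is finite). -/
def lam (X Y : T) (n : ℤ) : ℕ := (Module.length (𝒜 0) (HomDeg φ X Y n)).toNat

/-- The generalized Herbrand difference of index `d`:
`h(X, Y)(n) = ∑_{i=0}^{d-1} (-1)^{n+i} λ^{n+i}(X, Y)`. -/
def herbrand (d : ℕ) (X Y : T) (n : ℤ) : ℤ :=
  ∑ i ∈ Finset.range d, ((n + i).negOnePow : ℤ) * (lam φ X Y (n + i) : ℤ)

/-- `g` is the `i`-th Hilbert polynomial of `(X, Y)`: `g(n) = λ^{dn+i}(X, Y)` for `n ≫ 0`. -/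
def IsHilbertPoly (d : ℕ) (X Y : T) (i : ℕ) (g : Polynomial ℚ) : Prop :=
  ∀ᶠ n : ℤ in atTop, g.eval (n : ℚ) = (lam φ X Y (d * n + i) : ℚ)

open Classical in
/-- The `i`-th Hilbert polynomial of `(X, Y)`; it is unique when it exists. -/
def hilbertPoly (d : ℕ) (X Y : T) (i : ℕ) : Polynomial ℚ :=
  if h : ∃ g, IsHilbertPoly φ d X Y i g then h.choose else 0

open Classical in
/-- `1 + deg g`, with the convention that the zero polynomial has degree `-1`. -/
def succDegree (g : Polynomial ℚ) : ℕ := if g = 0 then 0 else g.natDegree + 1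

/-- The complexity `cx(X, Y) = 1 + max {deg gᵢ | i = 0, …, d - 1}`. -/
def cx (d : ℕ) (X Y : T) : ℕ :=
  (Finset.range d).sup fun i => succDegree (hilbertPoly φ d X Y i)

/-- The Euler characteristic `∑_{n ∈ ℤ} (-1)ⁿ λⁿ(X, Y)` (only used when the sum is finite). -/
def eulerChar (X Y : T) : ℤ := ∑ᶠ n : ℤ, (n.negOnePow : ℤ) * (lam φ X Y n : ℤ)

open Classical in
/-- The `s`-multiplicity `e^s(X, Y)`: for `s = 0` the Euler characteristic, and for `s ≥ 1` the
value of `Δ^{s-1} h(X, Y)(n)` for `n ≫ 0`, where `Δ f (n) = f (n + d) - f n`. -/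
def mult (d s : ℕ) (X Y : T) : ℤ :=
  if s = 0 then eulerChar φ X Y
  else if h : ∃ e : ℤ, ∀ᶠ n : ℤ in atTop, (fwdDiff (d : ℤ))^[s - 1] (herbrand φ d X Y) n = e
    then h.choose else 0

end Center

/-! ### Koszul objects -/

section Koszul

variable {T : Type u} [Category.{v} T] [Preadditive T] [HasShift T ℤ]
  [∀ n : ℤ, (shiftFunctor T n).Additive] [Limits.HasZeroObject T] [Pretriangulated T]
  {R : Type w} [CommRing R] {𝒜 : ℕ → AddSubgroup R} [GradedRing 𝒜] (φ : CentralAction T 𝒜)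

/-- The Koszul object `Y ⫽ z` of `z ∈ Rᵈ`: a cone of `φ_Y(z) : Y ⟶ Σᵈ Y`. -/
def koszul {d : ℕ} (Y : T) (z : 𝒜 d) : T :=
  (distinguished_cocone_triangle (φ.hom z Y)).choose

/-- The triangle `Y ⟶ Σᵈ Y ⟶ Y ⫽ z ⟶ Σ Y` that defines the Koszul object. -/
lemma koszul_distinguished {d : ℕ} (Y : T) (z : 𝒜 d) :
    ∃ (f : Y⟦(d : ℤ)⟧ ⟶ koszul φ Y z) (g : koszul φ Y z ⟶ Y⟦(1 : ℤ)⟧),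
      Triangle.mk (φ.hom z Y) f g ∈ distTriang T :=
  (distinguished_cocone_triangle (φ.hom z Y)).choose_spec

/-- `Y ⫽ (z₁, …, z_r) = (Y ⫽ (z₁, …, z_{r-1})) ⫽ z_r`, and `Y ⫽ () = Y`. -/
def koszulSeq {d : ℕ} (Y : T) (z : List (𝒜 d)) : T := z.foldl (koszul φ) Y

end Koszul

/-! ### The coefficient ring -/

/-- `A` contains an infinite field, or is local with infinite residue field. -/
def HasInfiniteFieldOrResidueField (A : Type w) [CommRing A] : Prop :=
  (∃ K : Subring A, IsField K ∧ Infinite K) ∨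
    ∃ _ : IsLocalRing A, Infinite (IsLocalRing.ResidueField A)

end TriMult

end

noncomputable section

namespace TriMult

universe v u w

/-! ### Prime avoidance and superficial elements -/

section Superficial

variable {R : Type*} [CommRing R]

/-! A general element `z` of `R^d` acts injectively on `Hom*(X, Y)` in high degrees. Applying
`Hom(X, -)` to the triangle of `Y ⫽ z` and counting lengths gives `λⁿ(X, Y⫽z) = λⁿ⁺ᵈ(X, Y) - λⁿ(X,
Y) + kₙ + kₙ₊₁`, where `kₙ` is the length of the kernel of `z` in degree `n` (`exists_lam_koszul`).
For large `n` the kernels vanish. Each Hilbert polynomial `g(t)` is then replaced by `g(t+1) -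
g(t)`, so a positive complexity drops by one. Since `d` is even, `h(X, Y⫽z) = Δh(X, Y)` eventually,
and induction on `s` reduces to `s = 1`.

For `s = 1` only finitely many `λⁿ(X, Y⫽z)` are nonzero. In their alternating sum the terms `kₙ +
kₙ₊₁` telescope, and `(-1)ⁿ(λⁿ⁺ᵈ - λⁿ) = h(n+1) - h(n)` telescopes to `h(N)` for large `N`
(`eventually_herbrand_eq_eulerChar`).

The element `z` comes from avoiding associated primes, which uses the infinite field or residue
field (`exists_superficial`). Applied to quotients by graded submodules, the same lemma yields the
Hilbert polynomials by Noetherian induction (`exists_poly_quotLam`). -/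

/-- Avoidance of finitely many ideals inside an additive subgroup that is stable under an infinite
set whose pairwise differences are units. -/
lemma exists_mem_forall_notMem (V : AddSubgroup R) (U : Set R) (hU : U.Infinite)
    (hUV : ∀ a ∈ U, ∀ v ∈ V, a * v ∈ V) (hunit : ∀ a ∈ U, ∀ b ∈ U, a ≠ b → IsUnit (a - b))
    (S : Set (Ideal R)) (hS : S.Finite) (hSV : ∀ P ∈ S, ∃ v ∈ V, v ∉ P) :
    ∃ v ∈ V, ∀ P ∈ S, v ∉ P := by
  induction S, hS using Set.Finite.induction_on with
  | empty => exact ⟨0, V.zero_mem, by simp⟩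
  | @insert P S _ hS ih =>
    obtain ⟨v, hv, hvS⟩ := ih fun P hP => hSV P (Set.mem_insert_of_mem _ hP)
    by_cases hvP : v ∈ P
    · obtain ⟨w, hw, hwP⟩ := hSV P (Set.mem_insert _ _)
      -- Each `Q` excludes at most one `a`: two of them would give `(a - b) * v ∈ Q` with `a - b` a
      -- unit, hence `v ∈ Q`.
      have hbad : (⋃ Q ∈ S, {a ∈ U | w + a * v ∈ Q}).Finite := by
        refine hS.biUnion fun Q hQ => Set.Subsingleton.finite ?_
        rintro a ⟨ha, ha'⟩ b ⟨hb, hb'⟩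
        by_contra hab
        refine hvS Q hQ ((Ideal.unit_mul_mem_iff_mem Q (hunit a ha b hb hab)).1 ?_)
        have := Q.sub_mem ha' hb'
        rwa [add_sub_add_left_eq_sub, ← sub_mul] at this
      obtain ⟨a, ha, ha'⟩ := (hU.sdiff hbad).nonempty
      refine ⟨w + a * v, V.add_mem hw (hUV a ha v hv), ?_⟩
      rintro Q (rfl | hQ) hmem
      · exact hwP ((Submodule.add_mem_iff_left Q (Q.mul_mem_left a hvP)).1 hmem)
      · exact ha' (Set.mem_biUnion hQ ⟨ha, hmem⟩)
    · refine ⟨v, hv, ?_⟩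
      rintro Q (rfl | hQ)
      exacts [hvP, hvS Q hQ]

/-- In a Noetherian module, a sufficiently general element `z` of `V` has the property that its
kernel is annihilated by a power of the ideal generated by `V`. -/
lemma exists_mem_pow_smul_eq_zero [IsNoetherianRing R] (M : Type*) [AddCommGroup M] [Module R M]
    [IsNoetherian R M] (V : AddSubgroup R) (U : Set R) (hU : U.Infinite)
    (hUV : ∀ a ∈ U, ∀ v ∈ V, a * v ∈ V) (hunit : ∀ a ∈ U, ∀ b ∈ U, a ≠ b → IsUnit (a - b)) :
    ∃ z ∈ V, ∃ t : ℕ, ∀ m : M, z • m = 0 → ∀ r ∈ Ideal.span (V : Set R) ^ t, r • m = 0 := by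
  obtain ⟨z, hz, hzP⟩ := exists_mem_forall_notMem V U hU hUV hunit
    (associatedPrimes R M ∩ {P | ∃ v ∈ V, v ∉ P}) ((associatedPrimes.finite R M).inter_of_left _)
    fun P hP => hP.2
  refine ⟨z, hz, ?_⟩
  let K : Submodule R M := LinearMap.ker (LinearMap.lsmul R M z)
  -- A minimal prime of the annihilator of `K` is associated to `M` and contains `z`, which
  -- annihilates `K`. By the choice of `z` such a prime contains all of `V`. Associated primes
  -- containing `V` cannot be avoided, and need not be.
  have hrad : Ideal.span (V : Set R) ≤ (Module.annihilator R K).radical := by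
    rw [← Ideal.sInf_minimalPrimes, Ideal.span_le]
    intro v hv
    rw [SetLike.mem_coe, Ideal.mem_sInf]
    intro P hP
    have hass := associatedPrimes.subset_of_injective K.injective_subtype
      (Module.associatedPrimes.minimalPrimes_annihilator_subset_associatedPrimes R K hP)
    by_contra hvP
    refine hzP P ⟨hass, v, hv, hvP⟩ (hP.1.2 (Module.mem_annihilator.2 fun m => ?_))
    exact Subtype.ext m.2
  obtain ⟨t, ht⟩ := Ideal.exists_pow_le_of_le_radical_of_fg hrad (IsNoetherian.noetherian _)
  refine ⟨t, fun m hm r hr => ?_⟩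
  exact congrArg Subtype.val (Module.mem_annihilator.1 (ht hr) (⟨m, hm⟩ : K))

variable (𝒜 : ℕ → AddSubgroup R) [GradedRing 𝒜]

/-- In the local case `U` is a set of representatives of the residue field: distinct ones differ by
an element outside the maximal ideal. -/
lemma HasInfiniteFieldOrResidueField.exists_infinite {A : Type*} [CommRing A]
    (h : HasInfiniteFieldOrResidueField A) :
    ∃ U : Set A, U.Infinite ∧ ∀ a ∈ U, ∀ b ∈ U, a ≠ b → IsUnit (a - b) := by
  rcases h with ⟨K, hK, hinf⟩ | ⟨_, hinf⟩
  · refine ⟨K, Set.infinite_coe_iff.1 hinf, fun a ha b hb hab => ?_⟩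
    obtain ⟨c, hc⟩ := hK.mul_inv_cancel (a := (⟨a, ha⟩ - ⟨b, hb⟩ : K))
      (by rwa [ne_eq, sub_eq_zero, Subtype.mk.injEq])
    exact IsUnit.of_mul_eq_one (c : A) (congrArg Subtype.val hc)
  · obtain ⟨f, hf⟩ := (IsLocalRing.residue_surjective (R := A)).hasRightInverse
    refine ⟨Set.range f, Set.infinite_range_of_injective hf.injective, ?_⟩
    rintro _ ⟨a, rfl⟩ _ ⟨b, rfl⟩ hab
    have hne : IsLocalRing.residue A (f a - f b) ≠ 0 := by
      rw [map_sub, hf a, hf b, sub_ne_zero]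
      rintro rfl
      exact hab rfl
    by_contra hu
    exact hne ((IsLocalRing.residue_eq_zero_iff _).2 hu)

/-- The general element can be taken homogeneous because `R^d` is itself an additive group stable
under `U ⊆ R⁰`. -/
lemma exists_superficial_pow [IsNoetherianRing R] (h : HasInfiniteFieldOrResidueField (𝒜 0))
    (d : ℕ) (M : Type*) [AddCommGroup M] [Module R M] [IsNoetherian R M] :
    ∃ z : 𝒜 d, ∃ t : ℕ, ∀ m : M, (z : R) • m = 0 →
      ∀ r ∈ Ideal.span (𝒜 d : Set R) ^ t, r • m = 0 := by
  obtain ⟨U, hU, hunit⟩ := h.exists_infinite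
  obtain ⟨z, hz, h⟩ := exists_mem_pow_smul_eq_zero M (𝒜 d) (Subtype.val '' U)
    (hU.image Subtype.val_injective.injOn) (by
      rintro _ ⟨a, -, rfl⟩ v hv
      simpa using SetLike.mul_mem_graded a.2 hv) (by
      rintro _ ⟨a, ha, rfl⟩ _ ⟨b, hb, rfl⟩ hab
      have := hunit a ha b hb fun h => hab (by rw [h])
      exact this.map (SetLike.GradeZero.subring 𝒜).subtype)
  exact ⟨⟨z, hz⟩, h⟩

/-! ### Powers of the ideal generated by `R^d` -/

variable {𝒜} {d : ℕ}

lemma exists_sub_mem_span (hgen : Subring.closure ((𝒜 0 : Set R) ∪ (𝒜 d : Set R)) = ⊤) (r : R) :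
    ∃ a ∈ 𝒜 0, r - a ∈ Ideal.span (𝒜 d : Set R) := by
  have hr : r ∈ Subring.closure ((𝒜 0 : Set R) ∪ (𝒜 d : Set R)) := hgen ▸ Subring.mem_top r
  induction hr using Subring.closure_induction with
  | mem x hx =>
    rcases hx with hx | hx
    · exact ⟨x, hx, by simp⟩
    · exact ⟨0, zero_mem _, by simpa using Ideal.subset_span hx⟩
  | zero => exact ⟨0, zero_mem _, by simp⟩
  | one => exact ⟨1, SetLike.GradedOne.one_mem, by simp⟩
  | add x y _ _ hx hy =>
    obtain ⟨a, ha, ha'⟩ := hx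
    obtain ⟨b, hb, hb'⟩ := hy
    exact ⟨a + b, add_mem ha hb, by simpa [add_sub_add_comm] using add_mem ha' hb'⟩
  | neg x _ hx =>
    obtain ⟨a, ha, ha'⟩ := hx
    refine ⟨-a, neg_mem ha, ?_⟩
    rw [show -x - -a = -(x - a) by ring]
    exact neg_mem ha'
  | mul x y _ _ hx hy =>
    obtain ⟨a, ha, ha'⟩ := hx
    obtain ⟨b, hb, hb'⟩ := hy
    refine ⟨a * b, by simpa using SetLike.mul_mem_graded ha hb, ?_⟩
    rw [show x * y - a * b = y * (x - a) + a * (y - b) by ring]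
    exact add_mem (Ideal.mul_mem_left _ _ ha') (Ideal.mul_mem_left _ _ hb')

/-- An element of the `t`-th power is a combination of products of `t` elements of `R^d`. Modulo the
next power only the classes of the coefficients modulo the ideal matter, and these have
representatives in `R⁰`. -/
lemma exists_sub_mem_span_pow_succ (hgen : Subring.closure ((𝒜 0 : Set R) ∪ (𝒜 d : Set R)) = ⊤)
    (t : ℕ) : ∀ r ∈ Ideal.span (𝒜 d : Set R) ^ t,
      ∃ a ∈ 𝒜 (d * t), r - a ∈ Ideal.span (𝒜 d : Set R) ^ (t + 1) := by
  induction t with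
  | zero => simpa using exists_sub_mem_span hgen
  | succ t ih =>
    have key : ∀ y ∈ Ideal.span (𝒜 d : Set R), ∀ x ∈ Ideal.span (𝒜 d : Set R) ^ t,
        ∃ a ∈ 𝒜 (d * (t + 1)), x * y - a ∈ Ideal.span (𝒜 d : Set R) ^ (t + 1 + 1) := by
      intro y hy
      induction hy using Submodule.span_induction with
      | mem v hv =>
        intro x hx
        obtain ⟨a, ha, ha'⟩ := ih x hx
        refine ⟨a * v, SetLike.mul_mem_graded ha hv, ?_⟩
        rw [← sub_mul, pow_succ]
        exact Ideal.mul_mem_mul ha' (Ideal.subset_span hv)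
      | zero => exact fun x _ => ⟨0, zero_mem _, by simp⟩
      | add y y' _ _ h h' =>
        intro x hx
        obtain ⟨a, ha, ha'⟩ := h x hx
        obtain ⟨b, hb, hb'⟩ := h' x hx
        exact ⟨a + b, add_mem ha hb, by simpa [mul_add, add_sub_add_comm] using add_mem ha' hb'⟩
      -- The coefficient is absorbed into `x`, which stays in the `t`-th power.
      | smul r y _ h =>
        intro x hx
        obtain ⟨a, ha, ha'⟩ := h (x * r) (Ideal.mul_mem_right _ _ hx)
        exact ⟨a, ha, by simpa [mul_assoc] using ha'⟩
    intro r hr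
    rw [pow_succ] at hr
    induction hr using Submodule.mul_induction_on' with
    | mem_mul_mem x hx y hy => exact key y hy x hx
    | add x _ y _ h h' =>
      obtain ⟨a, ha, ha'⟩ := h
      obtain ⟨b, hb, hb'⟩ := h'
      exact ⟨a + b, add_mem ha hb, by simpa [add_sub_add_comm] using add_mem ha' hb'⟩

/-- `R` is the sum of its components of degree at most `dt` and the `t`-th power of the ideal
generated by the component of degree `d`. -/
lemma exists_sub_mem_span_pow (hgen : Subring.closure ((𝒜 0 : Set R) ∪ (𝒜 d : Set R)) = ⊤)
    (t : ℕ) (r : R) : ∃ a ∈ AddSubgroup.closure {x | ∃ k ≤ d * t, x ∈ 𝒜 k},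
      r - a ∈ Ideal.span (𝒜 d : Set R) ^ t := by
  induction t with
  | zero => exact ⟨0, zero_mem _, by simp⟩
  | succ t ih =>
    obtain ⟨a, ha, ha'⟩ := ih
    obtain ⟨b, hb, hb'⟩ := exists_sub_mem_span_pow_succ hgen t _ ha'
    have hle : d * t ≤ d * (t + 1) := Nat.mul_le_mul_left d t.le_succ
    refine ⟨a + b, add_mem (AddSubgroup.closure_mono ?_ ha)
      (AddSubgroup.subset_closure ⟨d * t, hle, hb⟩), by rwa [← sub_sub]⟩
    rintro x ⟨k, hk, hx⟩
    exact ⟨k, hk.trans hle, hx⟩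

end Superficial

/-! ### Differences of polynomials -/

section Polynomials

open Polynomial

/-- Bernoulli polynomials satisfy `B_{n+1}(x + 1) - B_{n+1}(x) = (n + 1) xⁿ`. -/
lemma exists_taylor_sub_eq (g : ℚ[X]) : ∃ G : ℚ[X], taylor 1 G - G = g := by
  induction g using Polynomial.induction_on' with
  | add p q hp hq =>
    obtain ⟨P, rfl⟩ := hp
    obtain ⟨Q, rfl⟩ := hq
    exact ⟨P + Q, by rw [map_add]; ring⟩
  | monomial n a =>
    refine ⟨C (a / (n + 1)) * Polynomial.bernoulli (n + 1), ?_⟩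
    have h : taylor 1 (Polynomial.bernoulli (n + 1)) =
        Polynomial.bernoulli (n + 1) + (n + 1) • X ^ n := by
      rw [taylor_apply, map_one, add_comm X 1, bernoulli_comp_one_add_X, Nat.add_sub_cancel]
    have hn : (n + 1 : ℚ) ≠ 0 := by positivity
    rw [taylor_mul, taylor_C, h, mul_add, add_sub_cancel_left, ← C_mul_X_pow_eq_monomial,
      nsmul_eq_mul, ← mul_assoc]
    congr 1
    rw [← map_natCast C, ← C_mul]
    congr 1
    push_cast
    field_simp

lemma succDegree_le_iff (g : ℚ[X]) (k : ℕ) : succDegree g ≤ k ↔ g.degree < k := by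
  unfold succDegree
  split_ifs with h
  · simp [h]
  · rw [degree_eq_natDegree h, Nat.cast_lt, Nat.succ_le_iff]

/-- The `n`-th Taylor coefficient at `1` is the value there of the `n`-th Hasse derivative, which
the degree bound makes affine linear. -/
lemma coeff_taylor_sub_self (g : ℚ[X]) (n : ℕ) (h : g.natDegree ≤ n + 1) :
    (taylor 1 g - g).coeff n = (n + 1) * g.coeff (n + 1) := by
  have h2 : (hasseDeriv n g).natDegree < 2 := by
    have := natDegree_hasseDeriv_le g n
    omega
  rw [coeff_sub, taylor_coeff, eval_eq_sum_range' h2]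
  simp [Finset.sum_range_succ, hasseDeriv_coeff, add_comm 1 n]

/-- Truncated subtraction is right here: zero and nonzero constants, with `succDegree` equal to `0`
and `1`, both have difference zero. -/
lemma succDegree_taylor_sub_self (g : ℚ[X]) :
    succDegree (taylor 1 g - g) = succDegree g - 1 := by
  rcases Nat.eq_zero_or_pos g.natDegree with h0 | h0
  · rw [eq_C_of_natDegree_eq_zero h0]
    simp only [taylor_C, sub_self, succDegree]
    split_ifs <;> simp
  · obtain ⟨n, hn⟩ : ∃ n, g.natDegree = n + 1 := ⟨g.natDegree - 1, by omega⟩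
    have hg : g ≠ 0 := by rintro rfl; simp at hn
    have hsg : succDegree g = n + 2 := by rw [succDegree, if_neg hg, hn]
    have hc : (taylor 1 g - g).coeff n ≠ 0 := by
      rw [coeff_taylor_sub_self g n hn.le, ← hn, coeff_natDegree]
      exact mul_ne_zero (by positivity) (leadingCoeff_ne_zero.2 hg)
    rw [hsg]
    refine le_antisymm ((succDegree_le_iff _ _).2 ?_) ?_
    · have h1 : (taylor 1 g - g).degree < g.degree :=
        degree_sub_lt_right (degree_taylor g 1) hg (leadingCoeff_taylor 1 g)
      rwa [degree_eq_natDegree hg, hn] at h1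
    · by_contra! hlt
      have := (succDegree_le_iff _ _).1 (Nat.lt_succ_iff.1 hlt)
      exact hc (coeff_eq_zero_of_degree_lt this)

/-- A function on `ℤ` whose difference is eventually polynomial is eventually polynomial. -/
lemma exists_eventually_eval_eq_of_diff {f : ℤ → ℚ} {g : ℚ[X]}
    (h : ∀ᶠ n : ℤ in atTop, f (n + 1) - f n = g.eval (n : ℚ)) :
    ∃ G : ℚ[X], ∀ᶠ n : ℤ in atTop, G.eval (n : ℚ) = f n := by
  obtain ⟨G, rfl⟩ := exists_taylor_sub_eq g
  obtain ⟨N, hN⟩ := eventually_atTop.1 h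
  refine ⟨G + C (f N - G.eval (N : ℚ)), eventually_atTop.2 ⟨N, fun n hn => ?_⟩⟩
  induction n, hn using Int.leInduction with
  | base => simp
  | succ n hn ih =>
    have := hN n hn
    simp only [eval_sub, taylor_eval, eval_add, eval_C, Int.cast_add, Int.cast_one] at this ih ⊢
    linarith

lemma eq_of_eventually_eval_eq {p q : ℚ[X]}
    (h : ∀ᶠ n : ℤ in atTop, p.eval (n : ℚ) = q.eval (n : ℚ)) : p = q := by
  obtain ⟨N, hN⟩ := eventually_atTop.1 h
  refine eq_of_infinite_eval_eq p q (((Set.Ici_infinite N).image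
    (Int.cast_injective (α := ℚ)).injOn).mono ?_)
  rintro _ ⟨n, hn, rfl⟩
  exact hN n hn

end Polynomials

/-! ### Graded submodules of `Hom*(X, Y)` and their Hilbert functions -/

section Hilbert

variable {T : Type u} [Category.{v} T] [Preadditive T] [HasShift T ℤ]
  [∀ n : ℤ, (shiftFunctor T n).Additive]
  {R : Type w} [CommRing R] {𝒜 : ℕ → AddSubgroup R} [GradedRing 𝒜]
  (φ : CentralAction T 𝒜) (X Y : T)

variable {φ X Y} in
lemma HomStar.ext {x y : HomStar φ X Y}
    (h : ∀ n, HomStar.component φ X Y n x = HomStar.component φ X Y n y) : x = y :=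
  DFinsupp.ext h

variable {φ X Y} in
lemma HomStar.exists_eq_sum (x : HomStar φ X Y) :
    ∃ s : Finset ℤ, x = ∑ n ∈ s, HomStar.of φ X Y n (HomStar.component φ X Y n x) := by
  classical
  exact ⟨DFinsupp.support (β := fun n : ℤ => HomDeg φ X Y n) x,
    (DirectSum.sum_support_of (β := fun n : ℤ => HomDeg φ X Y n) x).symm⟩

variable {φ X Y} in
lemma HomStar.exists_component_eq_zero (x : HomStar φ X Y) :
    ∃ D : ℤ, ∀ n ≥ D, HomStar.component φ X Y n x = 0 := by
  obtain ⟨s, hs⟩ := x.exists_eq_sum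
  obtain ⟨D, hD⟩ := s.bddAbove
  refine ⟨D + 1, fun n hn => ?_⟩
  rw [hs, map_sum]
  refine Finset.sum_eq_zero fun i hi => HomStar.component_of_ne φ X Y i n ?_ _
  have := hD hi
  omega

lemma HomStar.of_injective (n : ℤ) : Function.Injective (HomStar.of φ X Y n) := fun f g h => by
  rw [← HomStar.component_of_same φ X Y n f, h, HomStar.component_of_same]

lemma HomStar.of_mem_ge {n₀ n : ℤ} (h : n₀ ≤ n) (f : HomDeg φ X Y n) :
    HomStar.of φ X Y n f ∈ HomStar.ge φ X Y n₀ :=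
  fun m hm => HomStar.component_of_ne φ X Y n m (by omega) f

/-- Multiplication by `z ∈ Rᵏ` as an `R⁰`-linear map `Hom(X, Σⁿ Y) → Hom(X, Σᵐ Y)`. -/
def actLinear {k : ℕ} (z : 𝒜 k) (n m : ℤ) (h : k + n = m) :
    HomDeg φ X Y n →ₗ[𝒜 0] HomDeg φ X Y m where
  __ := act φ X Y z n m h
  map_smul' a f := by
    have hz : (z : R) * (a : R) ∈ 𝒜 k := by simpa using SetLike.mul_mem_graded z.2 a.2
    exact (act_mul φ X Y z a (add_zero k) ⟨_, hz⟩ rfl n n m _ h h f).symm.trans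
      (act_mul φ X Y a z (zero_add k) ⟨_, hz⟩ (mul_comm _ _) n m m h _ h f)

@[simp]
lemma actLinear_apply {k : ℕ} (z : 𝒜 k) (n m : ℤ) (h : k + n = m) (f : HomDeg φ X Y n) :
    actLinear φ X Y z n m h f = act φ X Y z n m h f := rfl

variable {φ X Y}

/-- The degree `n` component of a submodule of `Hom*(X, Y)`. -/
def degPart (N : Submodule R (HomStar φ X Y)) (n : ℤ) : Submodule (𝒜 0) (HomDeg φ X Y n) where
  carrier := {f | HomStar.of φ X Y n f ∈ N}
  zero_mem' := by simp
  add_mem' {f g} hf hg := by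
    simpa only [Set.mem_ofPred_eq, map_add] using N.add_mem hf hg
  smul_mem' a f hf := by
    have := N.smul_mem (a : R) hf
    rwa [smul_of φ X Y a n n (by simp) f] at this

lemma mem_degPart {N : Submodule R (HomStar φ X Y)} {n : ℤ} {f : HomDeg φ X Y n} :
    f ∈ degPart N n ↔ HomStar.of φ X Y n f ∈ N := Iff.rfl

/-- A submodule of `Hom*(X, Y)` is graded if it contains the components of its elements. -/
def IsGradedSubmodule (N : Submodule R (HomStar φ X Y)) : Prop :=
  ∀ x ∈ N, ∀ n, HomStar.component φ X Y n x ∈ degPart N n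

lemma isGradedSubmodule_bot : IsGradedSubmodule (⊥ : Submodule R (HomStar φ X Y)) := by
  intro x hx n
  rw [(Submodule.mem_bot R).1 hx, map_zero]
  exact zero_mem _

variable {d : ℕ}

lemma component_smul_eq_zero {t : ℕ} {D : ℤ} {x : HomStar φ X Y}
    (hx : ∀ n ≥ D, HomStar.component φ X Y n x = 0) {a : R}
    (ha : a ∈ AddSubgroup.closure {x | ∃ k ≤ t, x ∈ 𝒜 k}) (n : ℤ) (hn : D + t ≤ n) :
    HomStar.component φ X Y n (a • x) = 0 := by
  induction ha using AddSubgroup.closure_induction with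
  | mem a ha =>
    obtain ⟨k, hk, ha⟩ := ha
    have := component_smul φ X Y ⟨a, ha⟩ (n - k) n (by ring) x
    rw [hx (n - k) (by omega), map_zero] at this
    exact this
  | zero => rw [zero_smul, map_zero]
  | add a b _ _ h h' => rw [add_smul, map_add, h, h', add_zero]
  | neg a _ h => rw [neg_smul, map_neg, h, neg_zero]

/-- Existence of superficial elements: multiplication by a suitable `z ∈ Rᵈ` is injective in high
degrees on the quotient by a graded submodule. -/
lemma exists_superficial [IsNoetherianRing R]
    (hgen : Subring.closure ((𝒜 0 : Set R) ∪ (𝒜 d : Set R)) = ⊤)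
    (hR0 : HasInfiniteFieldOrResidueField (𝒜 0)) (n₀ : ℤ)
    (hnoeth : IsNoetherian R (HomStar.ge φ X Y n₀))
    {N : Submodule R (HomStar φ X Y)} (hN : IsGradedSubmodule N) :
    ∃ (z : 𝒜 d) (c : ℤ), ∀ n ≥ c, ∀ m, ∀ h : d + n = m, ∀ f : HomDeg φ X Y n,
      act φ X Y z n m h f ∈ degPart N m → f ∈ degPart N n := by
  obtain ⟨z, t, hzt⟩ := exists_superficial_pow 𝒜 hR0 d
    (HomStar.ge φ X Y n₀ ⧸ N.comap (HomStar.ge φ X Y n₀).subtype)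
  let K : Submodule R (HomStar φ X Y) :=
    HomStar.ge φ X Y n₀ ⊓ N.comap (LinearMap.lsmul R _ (z : R))
  have hK : ∀ x ∈ K, ∀ r ∈ Ideal.span (𝒜 d : Set R) ^ t, r • x ∈ N := by
    intro x hx r hr
    have := hzt (Submodule.Quotient.mk ⟨x, hx.1⟩) (by
      rw [← Submodule.Quotient.mk_smul, Submodule.Quotient.mk_eq_zero]
      exact hx.2) r hr
    rw [← Submodule.Quotient.mk_smul, Submodule.Quotient.mk_eq_zero] at this
    exact this
  obtain ⟨S, hS⟩ := isNoetherian_submodule.1 hnoeth K inf_le_left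
  choose! D hD using fun x : HomStar φ X Y => x.exists_component_eq_zero
  obtain ⟨D', hD'⟩ := (S.image D).bddAbove
  -- The generators of `K` vanish from degree `D'` on, so ring elements of degree at most `d * t`
  -- cannot carry them to degree `D' + d * t` or beyond. There only coefficients in the `t`-th power
  -- contribute, and these send `K` into `N`.
  refine ⟨z, max n₀ (D' + (d * t : ℕ)), fun n hn m h f hf => ?_⟩
  have hfK : HomStar.of φ X Y n f ∈ K := by
    refine ⟨HomStar.of_mem_ge φ X Y (le_trans (le_max_left _ _) hn) f, ?_⟩
    change (z : R) • HomStar.of φ X Y n f ∈ N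
    rwa [smul_of φ X Y z n m h]
  have hfS := hfK
  rw [← hS] at hfS
  obtain ⟨c, -, hc⟩ := Submodule.mem_span_finset.1 hfS
  rw [← HomStar.component_of_same φ X Y n f, ← hc, map_sum]
  refine sum_mem fun x hx => ?_
  obtain ⟨a, ha, ha'⟩ := exists_sub_mem_span_pow hgen t (c x)
  have hxK : x ∈ K := hS ▸ Submodule.subset_span hx
  have hDx : D x ≤ D' := hD' (Finset.mem_coe.2 (Finset.mem_image_of_mem D hx))
  rw [← sub_add_cancel (c x) a, add_smul, map_add,
    component_smul_eq_zero (fun n hn => hD x n hn) ha n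
      (le_trans (by omega) (le_trans (le_max_right _ _) hn)), add_zero]
  exact hN _ (hK x hxK _ ha') n

/-- The length of the degree `n` component of the quotient of `Hom*(X, Y)` by a submodule. -/
def quotLam (N : Submodule R (HomStar φ X Y)) (n : ℤ) : ℕ :=
  (Module.length (𝒜 0) (HomDeg φ X Y n ⧸ degPart N n)).toNat

lemma quotLam_bot (n : ℤ) : quotLam (⊥ : Submodule R (HomStar φ X Y)) n = lam φ X Y n := by
  have h : degPart (⊥ : Submodule R (HomStar φ X Y)) n = ⊥ := by
    refine (Submodule.eq_bot_iff _).2 fun f hf => ?_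
    exact HomStar.of_injective φ X Y n
      (((Submodule.mem_bot R).1 (mem_degPart.1 hf)).trans (map_zero _).symm)
  rw [quotLam, lam, ((degPart (⊥ : Submodule R (HomStar φ X Y)) n).quotEquivOfEqBot h).length_eq]

lemma toNat_length_eq_add {A M M' M'' : Type*} [CommRing A] [AddCommGroup M] [Module A M]
    [AddCommGroup M'] [Module A M'] [AddCommGroup M''] [Module A M'']
    (hM : IsFiniteLength A M) (f : M' →ₗ[A] M) (g : M →ₗ[A] M'') (hf : Function.Injective f)
    (hg : Function.Surjective g) (H : Function.Exact f g) :
    (Module.length A M).toNat = (Module.length A M').toNat + (Module.length A M'').toNat := by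
  rw [Module.length_eq_add_of_exact f g hf hg H, ENat.toNat_add]
  · exact Module.length_ne_top_iff.2 (hM.of_injective hf)
  · exact Module.length_ne_top_iff.2 (hM.of_surjective hg)

/-- `N + z Hom^{≥ n₀}(X, Y)`. -/
def addMul (N : Submodule R (HomStar φ X Y)) (n₀ : ℤ) (z : 𝒜 d) : Submodule R (HomStar φ X Y) :=
  N ⊔ (HomStar.ge φ X Y n₀).map (LinearMap.lsmul R _ (z : R))

lemma component_mem_addMul {N : Submodule R (HomStar φ X Y)} (hN : IsGradedSubmodule N)
    {n₀ : ℤ} {z : 𝒜 d} {x : HomStar φ X Y} (hx : x ∈ addMul N n₀ z) (n m : ℤ) (h : d + n = m) :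
    ∃ y ∈ degPart N m, ∃ f : HomDeg φ X Y n, (n < n₀ → f = 0) ∧
      HomStar.component φ X Y m x = y + act φ X Y z n m h f := by
  obtain ⟨y, hy, _, ⟨x', hx', rfl⟩, rfl⟩ := Submodule.mem_sup.1 hx
  refine ⟨_, hN y hy m, HomStar.component φ X Y n x', hx' n, ?_⟩
  rw [map_add, LinearMap.lsmul_apply, component_smul φ X Y z n m h]

lemma act_mem_addMul {N : Submodule R (HomStar φ X Y)} {n₀ : ℤ} {z : 𝒜 d} (n m : ℤ)
    (h : d + n = m) (f : HomDeg φ X Y n) (hn : n₀ ≤ n) :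
    act φ X Y z n m h f ∈ degPart (addMul N n₀ z) m := by
  rw [mem_degPart, ← smul_of φ X Y z n m h]
  exact Submodule.mem_sup_right ⟨_, HomStar.of_mem_ge φ X Y hn f, rfl⟩

lemma isGradedSubmodule_addMul {N : Submodule R (HomStar φ X Y)} (hN : IsGradedSubmodule N)
    (n₀ : ℤ) (z : 𝒜 d) : IsGradedSubmodule (addMul N n₀ z) := by
  intro x hx m
  obtain ⟨y, hy, f, hf, h⟩ := component_mem_addMul hN hx (m - d) m (by ring)
  rw [h]
  refine add_mem (Submodule.mem_sup_left hy : _ ∈ addMul N n₀ z) ?_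
  by_cases hm : m - d < n₀
  · rw [hf hm, map_zero]
    exact zero_mem _
  · exact act_mem_addMul _ _ _ f (not_lt.1 hm)

/-- With `M = Hom*(X, Y)`, this counts lengths in `0 → (M/N)ₙ → (M/N)ₘ → (M/(N + z M^{≥ n₀}))ₘ → 0`,
where the first map is multiplication by `z`. -/
lemma quotLam_addMul (hfl : ∀ n, IsFiniteLength (𝒜 0) (HomDeg φ X Y n))
    {N : Submodule R (HomStar φ X Y)} (hN : IsGradedSubmodule N) {n₀ : ℤ} {z : 𝒜 d}
    (n m : ℤ) (h : d + n = m) (hn : n₀ ≤ n)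
    (hz : ∀ f : HomDeg φ X Y n, act φ X Y z n m h f ∈ degPart N m → f ∈ degPart N n) :
    quotLam N m = quotLam N n + quotLam (addMul N n₀ z) m := by
  have hle : degPart N m ≤ degPart (addMul N n₀ z) m := fun f hf => Submodule.mem_sup_left hf
  have hle' : degPart N n ≤ (degPart N m).comap (actLinear φ X Y z n m h) := fun f hf => by
    rw [Submodule.mem_comap, actLinear_apply, mem_degPart, ← smul_of φ X Y z n m h]
    exact N.smul_mem _ hf
  refine toNat_length_eq_add ((hfl m).of_surjective (Submodule.mkQ_surjective _))
    (Submodule.mapQ _ _ (actLinear φ X Y z n m h) hle') (Submodule.factor hle) ?_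
    (Submodule.factor_surjective hle) ?_
  · rw [injective_iff_map_eq_zero]
    intro q hq
    obtain ⟨f, rfl⟩ := Submodule.mkQ_surjective _ q
    rw [Submodule.mkQ_apply, Submodule.mapQ_apply, Submodule.Quotient.mk_eq_zero] at hq
    rw [Submodule.mkQ_apply, Submodule.Quotient.mk_eq_zero]
    exact hz f hq
  · intro q
    obtain ⟨f, rfl⟩ := Submodule.mkQ_surjective _ q
    rw [← LinearMap.comp_apply, Submodule.factor_comp_mk, Submodule.mkQ_apply,
      Submodule.Quotient.mk_eq_zero]
    constructor
    · intro hf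
      obtain ⟨y, hy, g, -, hg⟩ := component_mem_addMul hN (mem_degPart.1 hf) n m h
      rw [HomStar.component_of_same] at hg
      refine ⟨Submodule.Quotient.mk g, ?_⟩
      rw [Submodule.mapQ_apply, actLinear_apply, eq_comm, Submodule.mkQ_apply,
        Submodule.Quotient.eq, hg,
        add_sub_cancel_right]
      exact hy
    · rintro ⟨q, hq⟩
      obtain ⟨g, rfl⟩ := Submodule.mkQ_surjective _ q
      rw [Submodule.mkQ_apply, Submodule.mapQ_apply, actLinear_apply, eq_comm,
        Submodule.mkQ_apply, Submodule.Quotient.eq] at hq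
      rw [← sub_add_cancel f (act φ X Y z n m h g)]
      exact add_mem (hle hq) (act_mem_addMul _ _ _ g hn)

/-- The Hilbert function of `Hom*(X, Y) / N` is eventually polynomial on each residue class
modulo `d`. -/
lemma exists_poly_quotLam [IsNoetherianRing R] (hd : 0 < d)
    (hgen : Subring.closure ((𝒜 0 : Set R) ∪ (𝒜 d : Set R)) = ⊤)
    (hR0 : HasInfiniteFieldOrResidueField (𝒜 0)) (hXY : IsNoethFL φ X Y) (i : ℤ)
    {N : Submodule R (HomStar φ X Y)} (hN : IsGradedSubmodule N) :
    ∃ g : Polynomial ℚ, ∀ᶠ n : ℤ in atTop, g.eval (n : ℚ) = quotLam N (d * n + i) := by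
  obtain ⟨⟨n₀, hnoeth⟩, hfl⟩ := hXY
  -- The ascending induction runs on the part of `N` in degrees `≥ n₀`, since only `Hom^{≥ n₀}(X,
  -- Y)` is known to be Noetherian.
  obtain ⟨N₁, hN₁⟩ : ∃ N₁, N₁ = N.comap (HomStar.ge φ X Y n₀).subtype := ⟨_, rfl⟩
  induction N₁ using WellFoundedGT.induction generalizing N with
  | ind N₁ ih =>
    subst hN₁
    obtain ⟨z, c, hz⟩ := exists_superficial hgen hR0 n₀ hnoeth hN
    have hev : ∀ b : ℤ, ∀ᶠ n : ℤ in atTop, b ≤ d * n + i := fun b => by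
      refine eventually_atTop.2 ⟨max 0 (b - i), fun n hn => ?_⟩
      have h1 := le_trans (le_max_left _ _) hn
      have h2 := le_trans (le_max_right _ _) hn
      have h3 : (1 : ℤ) ≤ d := by exact_mod_cast hd
      nlinarith
    have hle : N ≤ addMul N n₀ z := le_sup_left
    rcases (Submodule.comap_mono (f := (HomStar.ge φ X Y n₀).subtype) hle).lt_or_eq with hlt | heq
    · obtain ⟨g, hg⟩ := ih _ hlt (isGradedSubmodule_addMul hN n₀ z) rfl
      -- The difference at `n` is the Hilbert function of the larger submodule at `n + 1`, hence the
      -- Taylor shift.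
      refine exists_eventually_eval_eq_of_diff (f := fun n => (quotLam N (d * n + i) : ℚ))
        (g := Polynomial.taylor 1 g) ?_
      filter_upwards [hev c, hev n₀, (tendsto_atTop_add_const_right _ (1 : ℤ) tendsto_id).eventually
        hg] with n hc hn hg
      have := quotLam_addMul hfl hN (d * n + i) (d * (n + 1) + i) (by ring) hn
        (hz _ hc _ (by ring))
      simp only [id, Int.cast_add, Int.cast_one] at hg
      rw [Polynomial.taylor_eval, hg, this]
      push_cast
      ring
    -- If the submodule does not grow, `z` maps high degrees into `N`; superficiality then puts all
    -- of these degrees into `N`.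
    · refine ⟨0, ?_⟩
      filter_upwards [hev c, hev n₀] with n hc hn
      have htop : degPart N (d * n + i) = ⊤ := by
        refine eq_top_iff.2 fun f _ => hz _ hc _ rfl f ?_
        have hmem : (⟨HomStar.of φ X Y _ (act φ X Y z _ _ rfl f),
            HomStar.of_mem_ge φ X Y (by omega) _⟩ : HomStar.ge φ X Y n₀) ∈
            (addMul N n₀ z).comap (HomStar.ge φ X Y n₀).subtype :=
          act_mem_addMul _ _ rfl f hn
        rw [← heq] at hmem
        exact hmem
      have : Subsingleton (HomDeg φ X Y (d * n + i) ⧸ degPart N (d * n + i)) :=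
        Submodule.Quotient.subsingleton_iff.2 htop
      rw [Polynomial.eval_zero, quotLam, Module.length_eq_zero]
      simp

lemma exists_isHilbertPoly [IsNoetherianRing R] (hd : 0 < d)
    (hgen : Subring.closure ((𝒜 0 : Set R) ∪ (𝒜 d : Set R)) = ⊤)
    (hR0 : HasInfiniteFieldOrResidueField (𝒜 0)) (hXY : IsNoethFL φ X Y) (i : ℕ) :
    ∃ g : Polynomial ℚ, IsHilbertPoly φ d X Y i g := by
  obtain ⟨g, hg⟩ := exists_poly_quotLam hd hgen hR0 hXY (i : ℤ) isGradedSubmodule_bot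
  refine ⟨g, ?_⟩
  simpa only [IsHilbertPoly, quotLam_bot] using hg

/-- Multiplication by a suitable `z ∈ Rᵈ` is injective on `Hom*(X, Y)` in high degrees. -/
lemma exists_act_injective [IsNoetherianRing R]
    (hgen : Subring.closure ((𝒜 0 : Set R) ∪ (𝒜 d : Set R)) = ⊤)
    (hR0 : HasInfiniteFieldOrResidueField (𝒜 0)) (hXY : IsNoethFL φ X Y) :
    ∃ (z : 𝒜 d) (c : ℤ), ∀ n ≥ c, ∀ m, ∀ h : d + n = m,
      Function.Injective (act φ X Y z n m h) := by
  obtain ⟨⟨n₀, hnoeth⟩, -⟩ := hXY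
  obtain ⟨z, c, hz⟩ := exists_superficial hgen hR0 n₀ hnoeth isGradedSubmodule_bot
  refine ⟨z, c, fun n hn m h => (injective_iff_map_eq_zero _).2 fun f hf => ?_⟩
  have := hz n hn m h f (by rw [hf]; exact zero_mem _)
  exact HomStar.of_injective φ X Y n
    (((Submodule.mem_bot R).1 (mem_degPart.1 this)).trans (map_zero _).symm)

end Hilbert

/-! ### Graded homomorphisms `Hom*(X, Y) → Hom*(X, W)` -/

section GradedHom

variable {T : Type u} [Category.{v} T] [Preadditive T] [HasShift T ℤ]
  [∀ n : ℤ, (shiftFunctor T n).Additive]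
  {R : Type w} [CommRing R] {𝒜 : ℕ → AddSubgroup R} [GradedRing 𝒜]
  (φ : CentralAction T 𝒜)

/-- Naturality along `g : Y ⟶ ΣW` leaves the action of `z` on `ΣW`. The graded center compares it
with `Σφ_W(z)` up to the sign `(-1)^k`, which is trivial for even `k`. -/
lemma CentralAction.hom_comp_of_degree_one {k : ℕ} (hk : Even k) (z : 𝒜 k) {Y W : T}
    (g : ShiftedHom Y W (1 : ℤ)) (c : ℤ) (h : 1 + (k : ℤ) = c) :
    ShiftedHom.comp (φ.hom z Y) g h =
      ShiftedHom.comp g (φ.hom z W) ((add_comm _ _).trans h) := by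
  have hc : φ.hom z (W⟦(1 : ℤ)⟧) = (φ.hom z W)⟦(1 : ℤ)⟧' ≫ (shiftComm W (k : ℤ) 1).hom := by
    have := (φ.toCenter k z).2 W
    rwa [Int.negOnePow_even _ (by exact_mod_cast hk), one_smul] at this
  have hnat : φ.hom z Y ≫ g⟦(k : ℤ)⟧' = g ≫ φ.hom z (W⟦(1 : ℤ)⟧) :=
    ((φ.toCenter k z).1.naturality g).symm
  have hcomm : (shiftComm W (k : ℤ) 1).hom =
      (shiftFunctorAdd' T (k : ℤ) 1 c ((add_comm _ _).trans h)).inv.app W ≫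
        (shiftFunctorAdd' T 1 (k : ℤ) c h).hom.app W := by
    change (shiftFunctorComm T (k : ℤ) 1).hom.app W = _
    rw [shiftFunctorComm_eq T (k : ℤ) 1 c ((add_comm _ _).trans h)]
    rfl
  unfold ShiftedHom.comp
  rw [← Category.assoc, hnat, hc, hcomm]
  simp only [Category.assoc]
  rw [Iso.hom_inv_id_app]
  erw [Category.comp_id]

/-- Elements of even degree of the graded center commute with morphisms of nonnegative degree. -/
lemma CentralAction.hom_comp {k : ℕ} (hk : Even k) (z : 𝒜 k) {Y W : T} {e : ℤ} (he : 0 ≤ e)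
    (g : ShiftedHom Y W e) (c : ℤ) (h : e + (k : ℤ) = c) :
    ShiftedHom.comp (φ.hom z Y) g h =
      ShiftedHom.comp g (φ.hom z W) ((add_comm _ _).trans h) := by
  induction e, he using Int.leInduction generalizing Y c with
  | base =>
    obtain ⟨f, rfl⟩ := (ShiftedHom.homEquiv (X := Y) (Y := W) (0 : ℤ) rfl).surjective g
    obtain rfl : (k : ℤ) = c := by omega
    change ShiftedHom.comp _ (ShiftedHom.mk₀ 0 rfl f) _ = ShiftedHom.comp (ShiftedHom.mk₀ 0 rfl f) _ _
    rw [ShiftedHom.comp_mk₀, ShiftedHom.mk₀_comp]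
    exact ((φ.toCenter k z).1.naturality f).symm
  | succ e he ih =>
    -- `g` factors as a morphism of degree one to `Σᵉ W` followed by the tautological morphism of
    -- degree `e` from `Σᵉ W` to `W`.
    let g' : ShiftedHom Y (W⟦e⟧) (1 : ℤ) :=
      g ≫ (shiftFunctorAdd' T e 1 (e + 1) rfl).hom.app W
    let i : ShiftedHom (W⟦e⟧) W e := 𝟙 (W⟦e⟧)
    have hg : g = ShiftedHom.comp g' i rfl := by
      simp [ShiftedHom.comp, g', i]
    rw [hg, ← ShiftedHom.comp_assoc (φ.hom z Y) g' i (rfl : 1 + (k : ℤ) = 1 + k) rfl (by omega),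
      φ.hom_comp_of_degree_one hk z g',
      ShiftedHom.comp_assoc g' (φ.hom z (W⟦e⟧)) i _ (rfl : e + (k : ℤ) = e + k) (by omega),
      ih i (e + k) rfl,
      ShiftedHom.comp_assoc g' i (φ.hom z W) rfl (add_comm (k : ℤ) e) (by omega)]

/-- A homomorphism `Hom*(X, Y) → Hom*(X, W)` of degree `e`, given by its components, that commutes
with the action of the elements of even degree. -/
structure GradedHom (X Y W : T) (e : ℤ) where
  /-- The components. -/
  app (n m : ℤ) (h : e + n = m) : HomDeg φ X Y n →+ HomDeg φ X W m
  app_act {k : ℕ} (hk : Even k) (z : 𝒜 k) (n m n' m' : ℤ) (h : e + n = m) (h' : e + n' = m')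
    (hn : k + n = n') (hm : k + m = m') (f : HomDeg φ X Y n) :
    app n' m' h' (act φ X Y z n n' hn f) = act φ X W z m m' hm (app n m h f)

namespace GradedHom

variable {φ} {X Y W Z : T} {e e' : ℤ}

/-- The composition of graded homomorphisms. -/
def comp (σ : GradedHom φ X W Z e') (τ : GradedHom φ X Y W e) : GradedHom φ X Y Z (e' + e) where
  app n m h := (σ.app (e + n) m (by rw [← h, add_assoc])).comp (τ.app n (e + n) rfl)
  app_act hk z n m n' m' h h' hn hm f := by
    simp only [AddMonoidHom.comp_apply]
    rw [τ.app_act hk z n (e + n) n' (e + n') rfl rfl hn (by omega),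
      σ.app_act hk z (e + n) m (e + n') m' _ _ _ hm]

/-- The inverse of a bijective graded homomorphism. -/
def symm (τ : GradedHom φ X Y W e) (hτ : ∀ n m h, Function.Bijective (τ.app n m h)) :
    GradedHom φ X W Y (-e) where
  app n m h := (AddEquiv.ofBijective (τ.app m n (by omega)) (hτ m n _)).symm.toAddMonoidHom
  app_act hk z n m n' m' h h' hn hm f := by
    apply (hτ m' n' (by omega)).1
    rw [τ.app_act hk z m n m' n' (by omega) (by omega) hm hn]
    exact ((AddEquiv.ofBijective (τ.app m' n' _) _).apply_symm_apply _).trans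
      (congrArg _ ((AddEquiv.ofBijective (τ.app m n _) _).apply_symm_apply f).symm)

lemma app_symm_app (τ : GradedHom φ X Y W e) (hτ : ∀ n m h, Function.Bijective (τ.app n m h))
    (n m : ℤ) (h : e + m = n) (h' : -e + n = m) (f : HomDeg φ X W n) :
    τ.app m n h ((τ.symm hτ).app n m h' f) = f :=
  (AddEquiv.ofBijective (τ.app m n h) (hτ m n h)).apply_symm_apply f

/-- The components of a graded homomorphism are linear over `R⁰`. -/
def linear (τ : GradedHom φ X Y W e) (n m : ℤ) (h : e + n = m) :
    HomDeg φ X Y n →ₗ[𝒜 0] HomDeg φ X W m where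
  __ := τ.app n m h
  map_smul' a f := τ.app_act Even.zero a n m n m h h (by simp) (by simp) f

/-- The additive map `Hom*(X, Y) → Hom*(X, W)` given by a graded homomorphism. -/
def starAddHom (τ : GradedHom φ X Y W e) : HomStar φ X Y →+ HomStar φ X W :=
  HomStar.lift φ X Y fun n => (HomStar.of φ X W (e + n)).comp (τ.app n (e + n) rfl)

lemma starAddHom_of (τ : GradedHom φ X Y W e) (n m : ℤ) (h : e + n = m) (f : HomDeg φ X Y n) :
    τ.starAddHom (HomStar.of φ X Y n f) = HomStar.of φ X W m (τ.app n m h f) := by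
  subst h
  exact HomStar.lift_of φ X Y _ n f

lemma component_starAddHom (τ : GradedHom φ X Y W e) (n m : ℤ) (h : e + n = m)
    (x : HomStar φ X Y) : HomStar.component φ X W m (τ.starAddHom x) =
      τ.app n m h (HomStar.component φ X Y n x) := by
  have key : (HomStar.component φ X W m).comp τ.starAddHom =
      (τ.app n m h).comp (HomStar.component φ X Y n) := by
    refine HomStar.addHom_ext φ X Y fun i f => ?_
    simp only [AddMonoidHom.comp_apply]
    rw [τ.starAddHom_of i (e + i) rfl]
    by_cases hi : i = n
    · subst hi
      subst h
      rw [HomStar.component_of_same, HomStar.component_of_same]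
    · rw [HomStar.component_of_ne φ X W _ _ (by omega), HomStar.component_of_ne φ X Y _ _ hi,
        map_zero]
  exact DFunLike.congr_fun key x

lemma starAddHom_smul (τ : GradedHom φ X Y W e) {k : ℕ} (hk : Even k) (z : 𝒜 k)
    (x : HomStar φ X Y) : τ.starAddHom ((z : R) • x) = (z : R) • τ.starAddHom x := by
  refine HomStar.ext fun m => ?_
  rw [τ.component_starAddHom (-e + m) m (by ring),
    component_smul φ X Y z (-e + m - k) (-e + m) (by ring),
    component_smul φ X W z (m - k) m (by ring),
    τ.component_starAddHom (-e + m - k) (m - k) (by ring)]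
  exact τ.app_act hk z _ _ _ _ _ _ _ _ _

/-- The `R`-linear map `Hom*(X, Y) → Hom*(X, W)` given by a graded homomorphism. -/
def star (τ : GradedHom φ X Y W e) {d : ℕ} (hd : Even d)
    (hgen : Subring.closure ((𝒜 0 : Set R) ∪ (𝒜 d : Set R)) = ⊤) :
    HomStar φ X Y →ₗ[R] HomStar φ X W where
  __ := τ.starAddHom
  map_smul' r := by
    have hr : r ∈ Subring.closure ((𝒜 0 : Set R) ∪ (𝒜 d : Set R)) := hgen ▸ Subring.mem_top r
    change ∀ x, τ.starAddHom (r • x) = r • τ.starAddHom x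
    induction hr using Subring.closure_induction with
    | mem r hr =>
      rcases hr with hr | hr
      · exact τ.starAddHom_smul Even.zero ⟨r, hr⟩
      · exact τ.starAddHom_smul hd ⟨r, hr⟩
    | zero => simp
    | one => simp
    | add r s _ _ hr hs => intro x; rw [add_smul, add_smul, map_add, hr, hs]
    | neg r _ hr => intro x; rw [neg_smul, neg_smul, map_neg, hr]
    | mul r s _ _ hr hs => intro x; rw [mul_smul, mul_smul, hr, hs]

lemma component_star (τ : GradedHom φ X Y W e) {d : ℕ} (hd : Even d)
    (hgen : Subring.closure ((𝒜 0 : Set R) ∪ (𝒜 d : Set R)) = ⊤) (n m : ℤ) (h : e + n = m)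
    (x : HomStar φ X Y) : HomStar.component φ X W m (τ.star hd hgen x) =
      τ.app n m h (HomStar.component φ X Y n x) :=
  τ.component_starAddHom n m h x

/-- Eventual Noetherianness is inherited by the middle term of an exact sequence. -/
lemma isNoetherian_ge {e : ℤ} (he : e ≤ 0) {e' : ℤ} (he' : 0 ≤ e') (τ : GradedHom φ X Y W e)
    (σ : GradedHom φ X W Z e')
    (hexact : ∀ n m p h h', Function.Exact (τ.app n m h) (σ.app m p h')) {d : ℕ} (hd : Even d)
    (hgen : Subring.closure ((𝒜 0 : Set R) ∪ (𝒜 d : Set R)) = ⊤) {n₀ : ℤ}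
    (hY : IsNoetherian R (HomStar.ge φ X Y n₀)) (hZ : IsNoetherian R (HomStar.ge φ X Z n₀)) :
    IsNoetherian R (HomStar.ge φ X W n₀) := by
  rw [isNoetherian_submodule] at hY hZ ⊢
  intro N hN
  refine Submodule.fg_of_fg_map_of_fg_inf_ker (σ.star hd hgen) (hZ _ ?_) ?_
  · rintro _ ⟨x, hx, rfl⟩ n hn
    rw [σ.component_star hd hgen (-e' + n) n (by ring), hN hx _ (by omega), map_zero]
  -- Since `e ≤ 0`, homogeneous preimages under `τ` still lie in degrees `≥ n₀`. The kernel part of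
  -- `N` is thus the image of a submodule of the Noetherian module `Hom^{≥ n₀}(X, Y)`.
  · have hle : N ⊓ LinearMap.ker (σ.star hd hgen) ≤
        (HomStar.ge φ X Y n₀).map (τ.star hd hgen) := by
      rintro x ⟨hx, hx'⟩
      obtain ⟨s, hs⟩ := x.exists_eq_sum
      rw [hs]
      refine sum_mem fun m _ => ?_
      by_cases hm : m < n₀
      · rw [hN hx m hm, map_zero]
        exact zero_mem _
      · obtain ⟨f, hf⟩ := (hexact (-e + m) m (e' + m) (by ring) rfl
          (HomStar.component φ X W m x)).1 (by
            rw [← σ.component_star hd hgen, LinearMap.mem_ker.1 hx', map_zero])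
        refine ⟨HomStar.of φ X Y _ f, HomStar.of_mem_ge φ X Y (by omega) f, ?_⟩
        exact (τ.starAddHom_of _ m (by ring) f).trans (by rw [hf])
    have heq : (HomStar.ge φ X Y n₀ ⊓ (N ⊓ LinearMap.ker (σ.star hd hgen)).comap
        (τ.star hd hgen)).map (τ.star hd hgen) = N ⊓ LinearMap.ker (σ.star hd hgen) := by
      refine le_antisymm (Submodule.map_le_iff_le_comap.2 inf_le_right) fun x hx => ?_
      obtain ⟨y, hy, rfl⟩ := hle hx
      exact ⟨y, ⟨hy, hx⟩, rfl⟩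
    exact heq ▸ (hY _ inf_le_left).map _

end GradedHom

/-- The graded homomorphism given by the composition with a morphism of nonnegative degree. -/
def postcomp (X : T) {Y W : T} {e : ℤ} (he : 0 ≤ e) (g : ShiftedHom Y W e) :
    GradedHom φ X Y W e where
  app n m h :=
    { toFun f := ShiftedHom.comp (show X ⟶ Y⟦n⟧ from f) g h
      map_zero' := ShiftedHom.zero_comp X n _ h
      map_add' f f' := ShiftedHom.add_comp (show X ⟶ Y⟦n⟧ from f) (show X ⟶ Y⟦n⟧ from f') _ h }
  app_act {k} hk z n m n' m' h h' hn hm f := by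
    change ShiftedHom.comp (ShiftedHom.comp _ _ _) _ _ = ShiftedHom.comp (ShiftedHom.comp _ _ _) _ _
    rw [ShiftedHom.comp_assoc (show ShiftedHom X Y n from f) (φ.hom z Y) g hn
        (rfl : e + (k : ℤ) = e + k) (by omega), φ.hom_comp hk z he g _ rfl,
      ShiftedHom.comp_assoc (show ShiftedHom X Y n from f) g (φ.hom z W) h _ (by omega)]

end GradedHom

/-! ### The long exact sequence of a Koszul object -/

section KoszulSequence

variable {T : Type u} [Category.{v} T] [Preadditive T] [HasShift T ℤ]
  [∀ n : ℤ, (shiftFunctor T n).Additive]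
  {R : Type w} [CommRing R] {𝒜 : ℕ → AddSubgroup R} [GradedRing 𝒜]
  (φ : CentralAction T 𝒜) (X Y : T) {d : ℕ}

/-- Composition with the tautological morphism of degree `d` from `Σᵈ Y` to `Y`. -/
def unshift (d : ℕ) : GradedHom φ X (Y⟦(d : ℤ)⟧) Y d :=
  postcomp φ X (Nat.cast_nonneg d) (𝟙 (Y⟦(d : ℤ)⟧) : Y⟦(d : ℤ)⟧ ⟶ Y⟦(d : ℤ)⟧)

lemma unshift_app (n m : ℤ) (h : d + n = m) (f : X ⟶ Y⟦(d : ℤ)⟧⟦n⟧) :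
    (unshift φ X Y d).app n m h f = f ≫ (shiftFunctorAdd' T (d : ℤ) n m h).inv.app Y := by
  change f ≫ (𝟙 (Y⟦(d : ℤ)⟧))⟦n⟧' ≫ _ = f ≫ _
  rw [CategoryTheory.Functor.map_id, Category.id_comp]

lemma unshift_bijective (n m : ℤ) (h : d + n = m) :
    Function.Bijective ((unshift φ X Y d).app n m h) := by
  have key : Function.Bijective fun f : X ⟶ Y⟦(d : ℤ)⟧⟦n⟧ =>
      f ≫ (shiftFunctorAdd' T (d : ℤ) n m h).inv.app Y :=
    ((((shiftFunctorAdd' T (d : ℤ) n m h).app Y).symm).homToEquiv (Z := X)).bijective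
  exact (funext fun f => unshift_app φ X Y n m h f :
    ⇑((unshift φ X Y d).app n m h) = _) ▸ key

lemma unshift_comp_hom (z : 𝒜 d) (n m : ℤ) (h : d + n = m) (f : X ⟶ Y⟦n⟧) :
    (unshift φ X Y d).app n m h (f ≫ (φ.hom z Y)⟦n⟧') = act φ X Y z n m h f :=
  (unshift_app φ X Y n m h _).trans (Category.assoc _ _ _)

variable [Limits.HasZeroObject T] [Pretriangulated T]

/-- The `n`-fold shift of a distinguished triangle carries signs `(-1)ⁿ` on its morphisms, which
change neither kernels nor images. -/
lemma shift_comp_mor₂_eq_zero_iff {t : Triangle T} (ht : t ∈ distTriang T) {X : T} (n : ℤ)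
    (f : X ⟶ t.obj₂⟦n⟧) : f ≫ t.mor₂⟦n⟧' = 0 ↔ ∃ g : X ⟶ t.obj₁⟦n⟧, g ≫ t.mor₁⟦n⟧' = f := by
  constructor
  · intro hf
    obtain ⟨g, hg⟩ : ∃ g : X ⟶ t.obj₁⟦n⟧, f = g ≫ (n.negOnePow • t.mor₁⟦n⟧') :=
      Triangle.coyoneda_exact₂ _ (Triangle.shift_distinguished t ht n) f (by
        change f ≫ (n.negOnePow • t.mor₂⟦n⟧') = 0
        rw [Linear.comp_units_smul, hf, smul_zero])
    refine ⟨n.negOnePow • g, ?_⟩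
    rw [Linear.units_smul_comp, ← Linear.comp_units_smul]
    exact hg.symm
  · rintro ⟨g, rfl⟩
    rw [Category.assoc, ← Functor.map_comp, comp_distTriang_mor_zero₁₂ t ht, Functor.map_zero,
      Limits.comp_zero]

/-- The long exact sequence obtained by applying `Hom(X, -)` to the triangle that defines the
Koszul object. -/
lemma exists_koszul_exact (z : 𝒜 d) :
    ∃ (b : GradedHom φ X Y (koszul φ Y z) (-d)) (c : GradedHom φ X (koszul φ Y z) Y 1),
      (∀ n m h h', Function.Exact (act φ X Y z n m h) (b.app m n h')) ∧
      (∀ n m p h h', Function.Exact (b.app n m h) (c.app m p h')) ∧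
      ∀ n m p h h', Function.Exact (c.app n m h) (act φ X Y z m p h') := by
  obtain ⟨f, g, ht⟩ := koszul_distinguished φ Y z
  have hb := fun n m h => unshift_bijective φ X Y (d := d) n m h
  let f' := postcomp φ X le_rfl (ShiftedHom.mk₀ (0 : ℤ) rfl f)
  have hf' : ∀ (n : ℤ) h (x : X ⟶ Y⟦(d : ℤ)⟧⟦n⟧), f'.app n n h x = x ≫ f⟦n⟧' :=
    fun n h x => ShiftedHom.comp_mk₀ _ 0 rfl f
  let c := postcomp φ X zero_le_one g
  have hc : ∀ (n m : ℤ) h (x : X ⟶ (koszul φ Y z)⟦n⟧),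
      c.app n m h x = (x ≫ g⟦n⟧') ≫ (shiftFunctorAdd' T 1 n m h).inv.app Y :=
    fun n m h x => (Category.assoc _ _ _).symm
  have hc0 : ∀ (n m : ℤ) h (x : X ⟶ (koszul φ Y z)⟦n⟧), c.app n m h x = 0 ↔ x ≫ g⟦n⟧' = 0 :=
    fun n m h x => by
      rw [hc]
      exact Preadditive.IsIso.comp_right_eq_zero _ _
  let b : GradedHom φ X Y (koszul φ Y z) (-d) :=
    { app := fun n m h => (f'.comp ((unshift φ X Y d).symm hb)).app n m (by omega)
      app_act := fun hk w n m n' m' h h' => (f'.comp _).app_act hk w n m n' m' _ _ }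
  -- `b` is `f` after the inverse of the bijection `unshift`; it is only ever evaluated on the image
  -- of `unshift`, so that inverse is never computed.
  have hbapp : ∀ (n m : ℤ) (h : d + n = m) h' (x : X ⟶ Y⟦(d : ℤ)⟧⟦n⟧),
      b.app m n h' ((unshift φ X Y d).app n m h x) = x ≫ f⟦n⟧' := by
    intro n m h h' x
    obtain rfl : -(d : ℤ) + m = n := h'
    change f'.app _ _ _ _ = _
    rw [← hf' (-(d : ℤ) + m) (by omega)]
    congr 1
    apply (hb _ _ h).1
    rw [GradedHom.app_symm_app]
  refine ⟨b, c, ?_, ?_, ?_⟩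
  · intro n m h h' y
    obtain ⟨x, rfl⟩ := (hb n m h).2 y
    rw [hbapp n m h h' x]
    refine (shift_comp_mor₂_eq_zero_iff ht n x).trans ⟨?_, ?_⟩
    · rintro ⟨w, rfl⟩
      exact ⟨w, (unshift_comp_hom φ X Y z n m h w).symm⟩
    · rintro ⟨w, hw⟩
      refine ⟨w, (hb n m h).1 ?_⟩
      rw [← hw]
      exact unshift_comp_hom φ X Y z n m h w
  · intro n m p h h' y
    refine (hc0 m p h' y).trans
      ((shift_comp_mor₂_eq_zero_iff (rot_of_distTriang _ ht) m y).trans ⟨?_, ?_⟩)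
    · rintro ⟨x, rfl⟩
      exact ⟨_, hbapp m n (by omega) h x⟩
    · rintro ⟨w, rfl⟩
      obtain ⟨x, rfl⟩ := (hb m n (by omega)).2 w
      exact ⟨x, (hbapp m n (by omega) h x).symm⟩
  · intro n m p h h' y
    have hsurj : ∀ y : X ⟶ Y⟦m⟧, ∃ x : X ⟶ Y⟦(1 : ℤ)⟧⟦n⟧,
        x ≫ (shiftFunctorAdd' T 1 n m h).inv.app Y = y :=
      fun y => ⟨y ≫ (shiftFunctorAdd' T 1 n m h).hom.app Y, by simp⟩
    obtain ⟨x, rfl⟩ := hsurj y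
    have hact := unshift_comp_hom φ X Y z m p h' (x ≫ (shiftFunctorAdd' T 1 n m h).inv.app Y)
    have hx : act φ X Y z m p h' (x ≫ (shiftFunctorAdd' T 1 n m h).inv.app Y) = 0 ↔
        (x ≫ (shiftFunctorAdd' T 1 n m h).inv.app Y) ≫ (φ.hom z Y)⟦m⟧' = 0 :=
      ⟨fun h0 => (hb m p h').1 ((hact.trans h0).trans (map_zero _).symm),
        fun h0 => hact.symm.trans ((congrArg _ h0).trans (map_zero _))⟩
    -- Two rotations of the triangle produce `-Σφ_Y(z)`; the sign does not affect the kernel.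
    have hneg : (x ≫ (shiftFunctorAdd' T 1 n m h).inv.app Y) ≫ (φ.hom z Y)⟦m⟧' = 0 ↔
        x ≫ (-(φ.hom z Y)⟦(1 : ℤ)⟧')⟦n⟧' = 0 := by
      rw [Category.assoc, ← (shiftFunctorAdd' T 1 n m h).inv.naturality (φ.hom z Y),
        ← Category.assoc, Functor.map_neg, Preadditive.comp_neg, neg_eq_zero]
      exact Preadditive.IsIso.comp_right_eq_zero _ _
    refine (hx.trans hneg).trans ((shift_comp_mor₂_eq_zero_iff
      (rot_of_distTriang _ (rot_of_distTriang _ ht)) n x).trans ⟨?_, ?_⟩)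
    · rintro ⟨w, rfl⟩
      exact ⟨w, hc n m h w⟩
    · rintro ⟨w, hw⟩
      refine ⟨w, ?_⟩
      have hw' : (w ≫ g⟦n⟧') ≫ (shiftFunctorAdd' T 1 n m h).inv.app Y =
          x ≫ (shiftFunctorAdd' T 1 n m h).inv.app Y := (hc n m h w).symm.trans hw
      exact ((shiftFunctorAdd' T 1 n m h).app Y).symm.homToEquiv.injective hw'

/-! ### Lengths in the long exact sequence -/

variable {φ X Y}

lemma toNat_length_eq_submodule_add_quotient {A M : Type*} [CommRing A] [AddCommGroup M]
    [Module A M] (hM : IsFiniteLength A M) (N : Submodule A M) :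
    (Module.length A M).toNat = (Module.length A N).toNat + (Module.length A (M ⧸ N)).toNat :=
  toNat_length_eq_add hM N.subtype N.mkQ N.injective_subtype N.mkQ_surjective
    (LinearMap.exact_subtype_mkQ N)

lemma toNat_length_eq_ker_add_range {A M M' : Type*} [CommRing A] [AddCommGroup M] [Module A M]
    [AddCommGroup M'] [Module A M'] (hM : IsFiniteLength A M) (f : M →ₗ[A] M') :
    (Module.length A M).toNat = (Module.length A (LinearMap.ker f)).toNat +
      (Module.length A (LinearMap.range f)).toNat :=
  toNat_length_eq_add hM (LinearMap.ker f).subtype f.rangeRestrict (Submodule.injective_subtype _)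
    f.surjective_rangeRestrict
    (by rw [LinearMap.exact_iff, LinearMap.ker_rangeRestrict, Submodule.range_subtype])

/-- The long exact sequence breaks into short ones, with the cokernel of `z` on degree `n` at the
left and its kernel on degree `n + 1` at the right. Here `k n` is the length of the kernel in degree
`n`; its two vanishing criteria serve the high and the low degrees respectively. -/
lemma exists_lam_koszul (hXY : IsNoethFL φ X Y) (hd : Even d)
    (hgen : Subring.closure ((𝒜 0 : Set R) ∪ (𝒜 d : Set R)) = ⊤) (z : 𝒜 d) :
    IsNoethFL φ X (koszul φ Y z) ∧ ∃ k : ℤ → ℕ,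
      (∀ n, Function.Injective (act φ X Y z n (d + n) rfl) → k n = 0) ∧
      (∀ n, lam φ X Y n = 0 → k n = 0) ∧
      ∀ n, lam φ X (koszul φ Y z) n + lam φ X Y n = lam φ X Y (d + n) + k n + k (n + 1) := by
  obtain ⟨⟨n₀, hnoeth⟩, hfl⟩ := hXY
  obtain ⟨b, c, hab, hbc, hca⟩ := exists_koszul_exact φ X Y z
  let a := fun n => actLinear φ X Y z n (d + n) rfl
  let b' := fun n => (LinearMap.range (a n)).liftQ (b.linear (d + n) n (by ring))
    (by rintro _ ⟨x, rfl⟩; exact (hab n (d + n) rfl (by ring)).apply_apply_eq_zero x)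
  let c' := fun n => (c.linear n (n + 1) (by ring)).codRestrict (LinearMap.ker (a (n + 1)))
    fun x => (hca n (n + 1) _ (by ring) rfl).apply_apply_eq_zero x
  have hb' : ∀ n, Function.Injective (b' n) := fun n => by
    rw [injective_iff_map_eq_zero]
    intro q hq
    obtain ⟨x, rfl⟩ := Submodule.mkQ_surjective _ q
    exact (Submodule.Quotient.mk_eq_zero _).2 ((hab n (d + n) rfl (by ring) x).1 hq)
  have hc' : ∀ n, Function.Surjective (c' n) := by
    rintro n ⟨x, hx⟩
    obtain ⟨y, hy⟩ := (hca n (n + 1) _ (by ring) rfl x).1 hx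
    exact ⟨y, Subtype.ext hy⟩
  have hbc' : ∀ n, Function.Exact (b' n) (c' n) := fun n y => by
    have h1 : c' n y = 0 ↔ c.app n (n + 1) (by ring) y = 0 := Subtype.ext_iff
    rw [h1, hbc (d + n) n (n + 1) (by ring) (by ring)]
    constructor
    · rintro ⟨x, rfl⟩
      exact ⟨Submodule.mkQ _ x, rfl⟩
    · rintro ⟨q, rfl⟩
      obtain ⟨x, rfl⟩ := Submodule.mkQ_surjective _ q
      exact ⟨x, rfl⟩
  have hflK : ∀ n, IsFiniteLength (𝒜 0) (HomDeg φ X (koszul φ Y z) n) := fun n => by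
    have h := Module.length_eq_add_of_exact (P := LinearMap.ker (a (n + 1))) (b' n) (c' n) (hb' n)
      (hc' n) (hbc' n)
    rw [← Module.length_ne_top_iff, h, ne_eq, ENat.add_eq_top, not_or]
    exact ⟨Module.length_ne_top_iff.2 ((hfl _).of_surjective (Submodule.mkQ_surjective _)),
      Module.length_ne_top_iff.2 ((hfl _).of_injective (Submodule.injective_subtype _))⟩
  refine ⟨⟨⟨n₀, b.isNoetherian_ge (by omega) zero_le_one c hbc hd hgen hnoeth hnoeth⟩, hflK⟩,
    fun n => (Module.length (𝒜 0) (LinearMap.ker (a n))).toNat, ?_, ?_, ?_⟩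
  · intro n hn
    have : LinearMap.ker (a n) = ⊥ := LinearMap.ker_eq_bot.2 hn
    dsimp only
    rw [this, Module.length_bot, ENat.toNat_zero]
  · intro n hn
    have := toNat_length_eq_ker_add_range (hfl n) (a n)
    unfold lam at hn
    dsimp only
    omega
  · intro n
    have h1 := toNat_length_eq_ker_add_range (hfl n) (a n)
    have h2 := toNat_length_eq_submodule_add_quotient (hfl (d + n)) (LinearMap.range (a n))
    have h3 := toNat_length_eq_add (M'' := LinearMap.ker (a (n + 1))) (hflK n) (b' n) (c' n) (hb' n) (hc' n) (hbc' n)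
    unfold lam
    dsimp only
    omega

end KoszulSequence

/-! ### Complexity, Herbrand differences and Euler characteristics -/

section Multiplicity

variable {T : Type u} [Category.{v} T] [Preadditive T] [HasShift T ℤ]
  [∀ n : ℤ, (shiftFunctor T n).Additive]
  {R : Type w} [CommRing R] {𝒜 : ℕ → AddSubgroup R} [GradedRing 𝒜]
  {φ : CentralAction T 𝒜} {X Y W : T} {d : ℕ}

lemma isHilbertPoly_hilbertPoly {i : ℕ} (h : ∃ g, IsHilbertPoly φ d X Y i g) :
    IsHilbertPoly φ d X Y i (hilbertPoly φ d X Y i) := by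
  unfold hilbertPoly
  rw [dif_pos h]
  exact h.choose_spec

lemma tendsto_mul_add_atTop (hd : 0 < d) (i : ℕ) :
    Tendsto (fun n : ℤ => d * n + i) atTop atTop :=
  tendsto_atTop_add_const_right _ _
    (tendsto_id.const_mul_atTop' (by exact_mod_cast hd))

/-- Since `d + (d * n + i) = d * (n + 1) + i`, a shift of the degree by `d` is a shift of the
polynomial variable by `1`. -/
lemma hilbertPoly_eq_taylor_sub (hd : 0 < d) {i : ℕ} (hY : ∃ g, IsHilbertPoly φ d X Y i g)
    (hW : ∃ g, IsHilbertPoly φ d X W i g)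
    (h : ∀ᶠ n : ℤ in atTop, lam φ X W n + lam φ X Y n = lam φ X Y (d + n)) :
    hilbertPoly φ d X W i =
      Polynomial.taylor 1 (hilbertPoly φ d X Y i) - hilbertPoly φ d X Y i := by
  refine eq_of_eventually_eval_eq ?_
  filter_upwards [isHilbertPoly_hilbertPoly hW, isHilbertPoly_hilbertPoly hY,
    (tendsto_atTop_add_const_right _ (1 : ℤ) tendsto_id).eventually (isHilbertPoly_hilbertPoly hY),
    (tendsto_mul_add_atTop hd i).eventually h] with n h1 h2 h3 h4
  simp only [id, Int.cast_add, Int.cast_one] at h3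
  rw [Polynomial.eval_sub, Polynomial.taylor_eval, h1, h2, h3,
    show (d : ℤ) * (n + 1) + i = d + (d * n + i) by ring, ← h4]
  push_cast
  ring

lemma cx_eq_sub_one (hd : 0 < d) (hY : ∀ i, ∃ g, IsHilbertPoly φ d X Y i g)
    (hW : ∀ i, ∃ g, IsHilbertPoly φ d X W i g)
    (h : ∀ᶠ n : ℤ in atTop, lam φ X W n + lam φ X Y n = lam φ X Y (d + n)) :
    cx φ d X W = cx φ d X Y - 1 := by
  unfold cx
  -- Truncated subtraction of `1` is monotone and fixes `0`, so it commutes with finite suprema in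
  -- `ℕ`.
  rw [Finset.apply_sup_eq_sup_comp (fun n : ℕ => n - 1)
    (fun a b => by simp only [Nat.max_def]; split_ifs <;> omega) rfl]
  refine Finset.sup_congr rfl fun i _ => ?_
  rw [hilbertPoly_eq_taylor_sub hd (hY i) (hW i) h, succDegree_taylor_sub_self]
  rfl

lemma eventually_lam_eq_zero (hd : 0 < d) (hY : ∀ i, ∃ g, IsHilbertPoly φ d X Y i g)
    (hcx : cx φ d X Y = 0) : ∀ᶠ n : ℤ in atTop, lam φ X Y n = 0 := by
  have h : ∀ i ∈ Finset.range d, ∀ᶠ n : ℤ in atTop, lam φ X Y (d * n + i) = 0 := by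
    intro i hi
    have h0 : hilbertPoly φ d X Y i = 0 := by
      by_contra hne
      have hle := Finset.le_sup (f := fun i => succDegree (hilbertPoly φ d X Y i)) hi
      change _ ≤ cx φ d X Y at hle
      rw [hcx] at hle
      simp [succDegree, hne] at hle
    filter_upwards [isHilbertPoly_hilbertPoly (hY i)] with n hn
    rw [h0, Polynomial.eval_zero] at hn
    exact_mod_cast hn.symm
  obtain ⟨N, hN⟩ := eventually_atTop.1 ((Filter.eventually_all_finset _).2 h)
  have hd' : (0 : ℤ) < d := by exact_mod_cast hd
  refine eventually_atTop.2 ⟨d * N, fun n hn => ?_⟩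
  have hi : (((n % d).toNat : ℕ) : ℤ) = n % d := Int.toNat_of_nonneg (Int.emod_nonneg _ hd'.ne')
  have hlt := Int.emod_lt_of_pos n hd'
  have := hN (n / d) ((Int.le_ediv_iff_mul_le hd').2 (by linarith)) (n % d).toNat
    (Finset.mem_range.2 (by omega))
  rwa [hi, Int.mul_ediv_add_emod] at this

/-- Sliding the window by one drops the term in degree `n` and gains the one in degree `n + d`;
their signs agree because `d` is even. -/
lemma herbrand_add_one (hd : Even d) (n : ℤ) :
    herbrand φ d X Y (n + 1) = herbrand φ d X Y n +
      n.negOnePow * (lam φ X Y (d + n) - lam φ X Y n) := by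
  have h := Finset.sum_range_succ' (fun i : ℕ => (((n + i).negOnePow : ℤˣ) : ℤ) *
    (lam φ X Y (n + i) : ℤ)) d
  rw [Finset.sum_range_succ] at h
  have h2 : herbrand φ d X Y (n + 1) = ∑ i ∈ Finset.range d,
      (((n + (i + 1 : ℕ)).negOnePow : ℤˣ) : ℤ) * (lam φ X Y (n + (i + 1 : ℕ)) : ℤ) :=
    Finset.sum_congr rfl fun i _ => by
      rw [show n + 1 + (i : ℤ) = n + (i + 1 : ℕ) by push_cast; ring]
  have hn : (n + d).negOnePow = n.negOnePow := by
    rw [Int.negOnePow_add, Int.negOnePow_even d (by exact_mod_cast hd), mul_one]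
  change herbrand φ d X Y n + _ = _ at h
  rw [← h2, hn, Nat.cast_zero, add_zero, add_comm n (d : ℤ)] at h
  linear_combination -h

lemma fwdDiff_herbrand_eq (hd : Even d) {n : ℤ}
    (h : ∀ m ≥ n, lam φ X W m + lam φ X Y m = lam φ X Y (d + m)) :
    fwdDiff (d : ℤ) (herbrand φ d X Y) n = herbrand φ d X W n := by
  unfold fwdDiff herbrand
  rw [← Finset.sum_sub_distrib]
  refine Finset.sum_congr rfl fun i _ => ?_
  have h1 := h (n + i) (by omega)
  rw [show n + d + (i : ℤ) = d + (n + i) by ring, ← h1, Int.negOnePow_add (d : ℤ),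
    Int.negOnePow_even d (by exact_mod_cast hd), one_mul]
  push_cast
  ring

lemma eventually_iterate_fwdDiff_congr (k : ℕ) {f g : ℤ → ℤ} (h : f =ᶠ[atTop] g) :
    (fwdDiff (d : ℤ))^[k] f =ᶠ[atTop] (fwdDiff (d : ℤ))^[k] g := by
  induction k generalizing f g with
  | zero => exact h
  | succ k ih =>
    refine ih ?_
    filter_upwards [h, (tendsto_atTop_add_const_right _ (d : ℤ) tendsto_id).eventually h]
      with n h1 h2
    simp only [fwdDiff, h1]
    exact congrArg (· - g n) h2

/-- The partial alternating sums telescope to `h(N) - (-1)^N k N`, whose last term vanishes for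
large `N`. -/
lemma eventually_herbrand_eq_eulerChar (hd : Even d) {k : ℤ → ℕ}
    (hk : ∀ n, lam φ X Y n = 0 → k n = 0) (hk' : ∀ᶠ n in atTop, k n = 0)
    (hlam : ∀ n, lam φ X W n + lam φ X Y n = lam φ X Y (d + n) + k n + k (n + 1))
    (hvan : ∃ n₀ : ℤ, ∀ n < n₀, lam φ X Y n = 0)
    (hW : ∀ᶠ n : ℤ in atTop, lam φ X W n = 0) :
    ∀ᶠ n : ℤ in atTop, herbrand φ d X Y n = eulerChar φ X W := by
  obtain ⟨n₀, hn₀⟩ := hvan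
  obtain ⟨n₁, hn₁⟩ := eventually_atTop.1 hW
  obtain ⟨n₂, hn₂⟩ := eventually_atTop.1 hk'
  -- At `A` the whole window of `h` and the kernel length vanish, and below `A` so do the lengths
  -- for `W`.
  obtain ⟨A, hA⟩ : ∃ A, A = n₀ - d - 1 := ⟨_, rfl⟩
  have hsum : ∀ N ≥ A, ∑ n ∈ Finset.Ico A N, (n.negOnePow : ℤ) * (lam φ X W n : ℤ) =
      herbrand φ d X Y N - N.negOnePow * k N := by
    intro N hN
    induction N, hN using Int.leInduction with
    | base =>
      rw [Finset.Ico_self, Finset.sum_empty, hk A (hn₀ _ (by omega)), herbrand,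
        Finset.sum_eq_zero]
      · simp
      · intro i hi
        rw [hn₀ _ (by have := Finset.mem_range.1 hi; omega)]
        simp
    | succ N hN ih =>
      have h1 : (lam φ X W N : ℤ) + lam φ X Y N = lam φ X Y (d + N) + k N + k (N + 1) := by
        exact_mod_cast hlam N
      rw [← Finset.insert_Ico_right_eq_Ico_add_one hN, Finset.sum_insert (by simp), ih,
        herbrand_add_one hd, Int.negOnePow_succ]
      push_cast
      linear_combination (N.negOnePow : ℤ) * h1
  refine eventually_atTop.2 ⟨max (max A n₁) n₂, fun N hN => ?_⟩
  have hN1 : A ≤ N := (le_max_left _ _).trans ((le_max_left _ _).trans hN)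
  have hN2 : n₁ ≤ N := (le_max_right _ _).trans ((le_max_left _ _).trans hN)
  have hN3 : n₂ ≤ N := (le_max_right _ _).trans hN
  have := hsum N hN1
  rw [hn₂ N hN3, Nat.cast_zero, mul_zero, sub_zero] at this
  rw [← this, eulerChar, finsum_eq_sum_of_support_subset]
  intro n hn
  have hn' : lam φ X W n ≠ 0 := fun h0 => hn (by simp [h0])
  rw [Finset.coe_Ico, Set.mem_Ico]
  constructor
  · by_contra! hlt
    have := hlam n
    rw [hn₀ (d + n) (by omega), hk n (hn₀ _ (by omega)), hk (n + 1) (hn₀ _ (by omega))] at this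
    omega
  · by_contra! hle
    exact hn' (hn₁ n (hN2.trans hle))

lemma finite_support_lam (hd : 0 < d) (hY : ∀ i, ∃ g, IsHilbertPoly φ d X Y i g)
    (hcx : cx φ d X Y = 0) (hvan : ∃ n₀ : ℤ, ∀ n < n₀, lam φ X Y n = 0) :
    {n : ℤ | lam φ X Y n ≠ 0}.Finite := by
  obtain ⟨n₀, hn₀⟩ := hvan
  obtain ⟨n₁, hn₁⟩ := eventually_atTop.1 (eventually_lam_eq_zero hd hY hcx)
  refine (Set.finite_Ico n₀ n₁).subset fun n hn => ⟨?_, ?_⟩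
  · by_contra! h
    exact hn (hn₀ n h)
  · by_contra! h
    exact hn (hn₁ n h)

lemma mult_eq_of_eventually {s : ℕ} (hs : 1 ≤ s) {e : ℤ}
    (h : ∀ᶠ n : ℤ in atTop, (fwdDiff (d : ℤ))^[s - 1] (herbrand φ d X Y) n = e) :
    mult φ d s X Y = e := by
  have hex : ∃ e : ℤ, ∀ᶠ n : ℤ in atTop,
      (fwdDiff (d : ℤ))^[s - 1] (herbrand φ d X Y) n = e := ⟨e, h⟩
  rw [mult, if_neg (by omega), dif_pos hex]
  obtain ⟨n, h1, h2⟩ := (hex.choose_spec.and h).exists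
  exact h1.symm.trans h2

/-! ### Induction on the complexity -/

variable [Limits.HasZeroObject T] [Pretriangulated T]

/-- The conclusion is phrased with differences of `herbrand` because `mult` changes form between `s
= 0` and `s ≥ 1`. The clause for `s = 0` records that the empty Koszul object is `Y`, which
identifies the Euler characteristic when the complexity drops from `1` to `0`. -/
theorem exists_koszulSeq_multiplicity [IsNoetherianRing R] (hd : Even d) (hd0 : 0 < d)
    (hgen : Subring.closure ((𝒜 0 : Set R) ∪ (𝒜 d : Set R)) = ⊤)
    (hR0 : HasInfiniteFieldOrResidueField (𝒜 0)) (s : ℕ) (Y : T) (hXY : IsNoethFL φ X Y)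
    (hs : cx φ d X Y = s) (hvan : ∃ n₀ : ℤ, ∀ n < n₀, lam φ X Y n = 0) :
    ∃ z : Fin s → 𝒜 d,
      (∀ n : ℤ, IsFiniteLength (𝒜 0) (HomDeg φ X (koszulSeq φ Y (List.ofFn z)) n)) ∧
      {n : ℤ | lam φ X (koszulSeq φ Y (List.ofFn z)) n ≠ 0}.Finite ∧
      (s = 0 → koszulSeq φ Y (List.ofFn z) = Y) ∧
      (1 ≤ s → ∀ᶠ n : ℤ in atTop, (fwdDiff (d : ℤ))^[s - 1] (herbrand φ d X Y) n =
        eulerChar φ X (koszulSeq φ Y (List.ofFn z))) := by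
  induction s generalizing Y with
  | zero =>
    exact ⟨Fin.elim0, hXY.2, finite_support_lam hd0 (exists_isHilbertPoly hd0 hgen hR0 hXY) hs hvan,
      fun _ => rfl, fun h => absurd h (by omega)⟩
  | succ s ih =>
    obtain ⟨z, c, hz⟩ := exists_act_injective hgen hR0 hXY
    obtain ⟨hK, k, hk, hk0, hlam⟩ := exists_lam_koszul hXY hd hgen z
    have hkc : ∀ n ≥ c, k n = 0 := fun n hn => hk n (hz n hn _ rfl)
    have hlamc : ∀ n ≥ c, lam φ X (koszul φ Y z) n + lam φ X Y n = lam φ X Y (d + n) :=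
      fun n hn => by rw [hlam, hkc n hn, hkc (n + 1) (by omega), add_zero, add_zero]
    have hpY := exists_isHilbertPoly hd0 hgen hR0 hXY
    have hpK := exists_isHilbertPoly hd0 hgen hR0 hK
    have hcx : cx φ d X (koszul φ Y z) = s := by
      rw [cx_eq_sub_one hd0 hpY hpK (eventually_atTop.2 ⟨c, hlamc⟩), hs, Nat.add_sub_cancel]
    have hvanK : ∃ n₀ : ℤ, ∀ n < n₀, lam φ X (koszul φ Y z) n = 0 := by
      obtain ⟨n₀, hn₀⟩ := hvan
      refine ⟨n₀ - d - 1, fun n hn => ?_⟩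
      have := hlam n
      rw [hn₀ (d + n) (by omega), hk0 n (hn₀ _ (by omega)), hk0 (n + 1) (hn₀ _ (by omega))] at this
      omega
    obtain ⟨zs, hfl, hfin, h0, hmult⟩ := ih _ hK hcx hvanK
    have hlist : koszulSeq φ Y (List.ofFn (Fin.cons z zs : Fin (s + 1) → 𝒜 d)) =
        koszulSeq φ (koszul φ Y z) (List.ofFn zs) := by
      rw [List.ofFn_succ]
      rfl
    refine ⟨Fin.cons z zs, ?_⟩
    rw [hlist]
    refine ⟨hfl, hfin, fun h => absurd h (by omega), fun _ => ?_⟩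
    rw [Nat.add_sub_cancel]
    -- Complexity one is the telescoping case. Above it, one difference of `h` is traded for the
    -- Koszul object and the induction hypothesis supplies the rest.
    rcases Nat.eq_zero_or_pos s with rfl | hpos
    · rw [h0 rfl]
      exact eventually_herbrand_eq_eulerChar hd hk0 (eventually_atTop.2 ⟨c, hkc⟩) hlam hvan
        (eventually_lam_eq_zero hd0 hpK hcx)
    · obtain ⟨t, rfl⟩ : ∃ t, s = t + 1 := ⟨s - 1, by omega⟩
      have hdiff : fwdDiff (d : ℤ) (herbrand φ d X Y) =ᶠ[atTop]
          herbrand φ d X (koszul φ Y z) :=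
        eventually_atTop.2 ⟨c, fun n hn =>
          fwdDiff_herbrand_eq hd fun m hm => hlamc m (le_trans hn hm)⟩
      filter_upwards [eventually_iterate_fwdDiff_congr (d := d) t hdiff, hmult hpos] with n h1 h2
      rw [Function.iterate_succ_apply, h1]
      exact h2

end Multiplicity

end TriMult

end

theorem mainTheorem1 {R : Type*} [CommRing R] [IsNoetherianRing R]
    (𝒜 : ℕ → AddSubgroup R) [GradedRing 𝒜]
    (d : ℕ) (hd : Even d) (hd2 : 2 ≤ d)
    (hgen : Subring.closure ((𝒜 0 : Set R) ∪ (𝒜 d : Set R)) = ⊤)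
    {T : Type*} [Category T] [Preadditive T] [Limits.HasZeroObject T] [HasShift T ℤ]
    [∀ n : ℤ, (shiftFunctor T n).Additive] [Pretriangulated T] [IsTriangulated T]
    (φ : TriMult.CentralAction T 𝒜) (X Y : T)
    (hXY : TriMult.IsNoethFL φ X Y)
    (hR0 : TriMult.HasInfiniteFieldOrResidueField (𝒜 0))
    (s : ℕ) (hs : s = TriMult.cx φ d X Y)
    (hvan : ∃ n₀ : ℤ, ∀ n < n₀, TriMult.lam φ X Y n = 0) :
    -- the complexity and the multiplicity are well defined
    (∀ i < d, ∃ g : Polynomial ℚ, TriMult.IsHilbertPoly φ d X Y i g) ∧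
    (1 ≤ s → ∀ᶠ n : ℤ in atTop,
      (fwdDiff (d : ℤ))^[s - 1] (TriMult.herbrand φ d X Y) n = TriMult.mult φ d s X Y) ∧
    -- the multiplicity is an Euler characteristic
    ∃ z : Fin s → 𝒜 d,
      (∀ n : ℤ, IsFiniteLength (𝒜 0)
        (TriMult.HomDeg φ X (TriMult.koszulSeq φ Y (List.ofFn z)) n)) ∧
      {n : ℤ | TriMult.lam φ X (TriMult.koszulSeq φ Y (List.ofFn z)) n ≠ 0}.Finite ∧
      TriMult.mult φ d s X Y =
        TriMult.eulerChar φ X (TriMult.koszulSeq φ Y (List.ofFn z)) := by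
  have hd0 : 0 < d := by omega
  have hpoly := TriMult.exists_isHilbertPoly hd0 hgen hR0 hXY
  obtain ⟨z, hfl, hfin, h0, hmult⟩ :=
    TriMult.exists_koszulSeq_multiplicity hd hd0 hgen hR0 s Y hXY hs.symm hvan
  refine ⟨fun i _ => hpoly i, fun h => ?_, z, hfl, hfin, ?_⟩
  · rw [TriMult.mult_eq_of_eventually h (hmult h)]
    exact hmult h
  · rcases Nat.eq_zero_or_pos s with rfl | hpos
    · rw [h0 rfl, TriMult.mult, if_pos rfl]
    · exact TriMult.mult_eq_of_eventually hpos (hmult hpos)
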